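/- **Lemma.** Let $U=\{0,\dots,n-1\}$ with its usual order. For $X,Y\subseteq U$ put $I_{X,Y}=(-1)^{|\{(x,y)\in X\times Y\,:\,x>y\}|}$. Call a triple $(A,B,C)$ of subsets of $U$ *allowed* if for every $v\in U$ the triple $([v\in A],[v\in B],[v\in C])$ is one of $(0,0,0)$, $(1,0,0)$, $(1,0,1)$, $(0,1,0)$, $(0,1,1)$, $(1,1,1)$; there are $6^n$ allowed triples. For $f,g:2^U\times 2^U\times 2^U\to\mathbb{Z}$ that vanish at all triples that are not allowed, let $$h(A,B,C)=\sum_{\substack{A_1\uplus A_2=A\\ B_1\uplus B_2=B\\ C_1\uplus C_2=C}} f(A_1,B_1,C_1)\,g(A_2,B_2,C_2)\,I_{B_1,B_2}\,I_{C_1,C_2},$$ where $X_1\uplus X_2=X$ means $X_1\cup X_2=X$ and $X_1\cap X_2=\emptyset$. Let $\omega$ be the matrix multiplication exponent, that is, the infimum of all real $\tau$ such that two $m\times m$ matrices over $\mathbb{Q}$ can be multiplied with $O(m^{\tau})$ arithmetic operations (straight-line computations with $+,-,\times$ and rational constants). Then the values of $h$ at all allowed triples can be computed from $n$ and the tables of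 the values of $f$ and $g$ at the allowed triples in time $O^*\big((2^{\omega}+2)^{n}\big)$ (in the application $n=tw$). In detail: for every $\varepsilon>0$ there are a program for an integer random access machine with logarithmic cost (every operation is charged according to the bit lengths of the numbers and addresses involved) and constants $K,k\in\mathbb{N}$ such that for all $n,L\ge 0$ and all such $f,g$ whose values have at most $L$ bits, the program halts with the correct table of $h$ after time at most $$K\,(n+L+1)^{k}\,\big(2^{\omega+\varepsilon}+2\big)^{n}.$$ -/

import Mathlib

/-! ### Sign factors, the join convolution, and the allowed triples -/

/-- `I_{A,B} = (-1)^{|{(a,b) ∈ A × B : a > b}|}` for subsets of a linearly ordered set. -/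
def orderSign {U : Type*} [LinearOrder U] (A B : Finset U) : ℤ :=
  (-1) ^ ((A ×ˢ B).filter (fun p => p.2 < p.1)).card

/-- All pairs `(A₁, A₂)` with `A₁ ⊎ A₂ = A`. -/
def splits {U : Type*} [Fintype U] [DecidableEq U] (A : Finset U) :
    Finset (Finset U × Finset U) :=
  Finset.univ.filter (fun p => p.1 ∪ p.2 = A ∧ p.1 ∩ p.2 = ∅)

/-- The join convolution
`h(A,B,C) = ∑ f(A₁,B₁,C₁) g(A₂,B₂,C₂) I_{B₁,B₂} I_{C₁,C₂}`, the sum being over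
`A₁ ⊎ A₂ = A`, `B₁ ⊎ B₂ = B`, `C₁ ⊎ C₂ = C`. -/
def joinConv {U : Type*} [Fintype U] [LinearOrder U]
    (f g : Finset U → Finset U → Finset U → ℤ) (A B C : Finset U) : ℤ :=
  ∑ a ∈ splits A, ∑ b ∈ splits B, ∑ c ∈ splits C,
    f a.1 b.1 c.1 * g a.2 b.2 c.2 * orderSign b.1 b.2 * orderSign c.1 c.2

/-- The triple `(A, B, C)` is allowed: for each `v` the triple of truth values
`([v ∈ A], [v ∈ B], [v ∈ C])` is one of
`(0,0,0), (1,0,0), (1,0,1), (0,1,0), (0,1,1), (1,1,1)`. -/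
def AllowedTriple {U : Type*} (A B C : Finset U) : Prop :=
  ∀ v : U,
    (v ∉ A ∧ v ∉ B ∧ v ∉ C) ∨ (v ∈ A ∧ v ∉ B ∧ v ∉ C) ∨ (v ∈ A ∧ v ∉ B ∧ v ∈ C) ∨
    (v ∉ A ∧ v ∈ B ∧ v ∉ C) ∨ (v ∉ A ∧ v ∈ B ∧ v ∈ C) ∨ (v ∈ A ∧ v ∈ B ∧ v ∈ C)

/-- `f` takes nonzero values only at allowed triples. -/
def SupportedOnAllowed {U : Type*} (f : Finset U → Finset U → Finset U → ℤ) : Prop :=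
  ∀ A B C, f A B C ≠ 0 → AllowedTriple A B C

/-! ### Tables of the `6 ^ n` allowed triples over `U = {0, …, n-1}`

Row `i < 6 ^ n` of a table belongs to the allowed triple in which the vertex `v` has the state
given by the `v`-th base-6 digit of `i`; the digits `0, 1, 2, 3, 4, 5` stand for
`(0,0,0), (1,0,0), (1,0,1), (0,1,0), (0,1,1), (1,1,1)`. -/

def rowA (n i : ℕ) : Finset (Fin n) :=
  Finset.univ.filter (fun v => i / 6 ^ (v : ℕ) % 6 ∈ ({1, 2, 5} : Finset ℕ))

def rowB (n i : ℕ) : Finset (Fin n) :=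
  Finset.univ.filter (fun v => i / 6 ^ (v : ℕ) % 6 ∈ ({3, 4, 5} : Finset ℕ))

def rowC (n i : ℕ) : Finset (Fin n) :=
  Finset.univ.filter (fun v => i / 6 ^ (v : ℕ) % 6 ∈ ({2, 4, 5} : Finset ℕ))

/-- The rows of a table are exactly the allowed triples. -/
theorem allowedTriple_iff_row (n : ℕ) (A B C : Finset (Fin n)) :
    AllowedTriple A B C ↔ ∃ i < 6 ^ n, rowA n i = A ∧ rowB n i = B ∧ rowC n i = C := by
  constructor
  · intro h
    have h' : ∀ v : Fin n, ∃ d : Fin 6,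
        (v ∈ A ↔ (d : ℕ) ∈ ({1, 2, 5} : Finset ℕ)) ∧
        (v ∈ B ↔ (d : ℕ) ∈ ({3, 4, 5} : Finset ℕ)) ∧
        (v ∈ C ↔ (d : ℕ) ∈ ({2, 4, 5} : Finset ℕ)) := by
      intro v
      rcases h v with ⟨a, b, c⟩ | ⟨a, b, c⟩ | ⟨a, b, c⟩ | ⟨a, b, c⟩ | ⟨a, b, c⟩ | ⟨a, b, c⟩
      · exact ⟨0, by simp [a, b, c]⟩
      · exact ⟨1, by simp [a, b, c]⟩
      · exact ⟨2, by simp [a, b, c]⟩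
      · exact ⟨3, by simp [a, b, c]⟩
      · exact ⟨4, by simp [a, b, c]⟩
      · exact ⟨5, by simp [a, b, c]⟩
    choose d hd using h'
    have key : ∀ v : Fin n,
        ((finFunctionFinEquiv d : Fin (6 ^ n)) : ℕ) / 6 ^ (v : ℕ) % 6 = (d v : ℕ) := by
      intro v
      exact congrArg Fin.val (congrFun (finFunctionFinEquiv.symm_apply_apply d) v)
    refine ⟨(finFunctionFinEquiv d : Fin (6 ^ n)), (finFunctionFinEquiv d).isLt, ?_, ?_, ?_⟩
    · ext v
      simp only [rowA, Finset.mem_filter, Finset.mem_univ, true_and, key]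
      exact (hd v).1.symm
    · ext v
      simp only [rowB, Finset.mem_filter, Finset.mem_univ, true_and, key]
      exact (hd v).2.1.symm
    · ext v
      simp only [rowC, Finset.mem_filter, Finset.mem_univ, true_and, key]
      exact (hd v).2.2.symm
  · rintro ⟨i, -, rfl, rfl, rfl⟩ v
    have h6 : i / 6 ^ (v : ℕ) % 6 < 6 := Nat.mod_lt _ (by norm_num)
    simp only [rowA, rowB, rowC, Finset.mem_filter, Finset.mem_univ, true_and]
    generalize i / 6 ^ (v : ℕ) % 6 = r at h6
    interval_cases r <;> simp

/-! ### Machine model: integer random access machine with logarithmic cost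

The memory consists of integer arrays `0, 1, 2, …` (a program mentions finitely many of them),
each indexed by integers. Every operation is charged by the bit lengths of the numbers and
addresses that it handles. -/

/-- Number of binary digits of `|z|`. -/
def bitLength (z : ℤ) : ℕ := z.natAbs.size

/-- `s a i` is the content of cell `i` of array `a`. -/
abbrev RamState := ℕ → ℤ → ℤ

inductive RamOp
  | add
  | sub
  | mul
  /-- integer quotient, rounded down for a positive divisor; the quotient by zero is zero -/
  | div

def RamOp.eval : RamOp → ℤ → ℤ → ℤ
  | .add, x, y => x + y
  | .sub, x, y => x - y
  | .mul, x, y => x * y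
  | .div, x, y => x / y

inductive RamExpr
  | const (z : ℤ)
  /-- the content of the cell of array `a` whose index is the value of `e` -/
  | read (a : ℕ) (e : RamExpr)
  | op (o : RamOp) (e₁ e₂ : RamExpr)

def RamExpr.eval (s : RamState) : RamExpr → ℤ
  | .const z => z
  | .read a e => s a (e.eval s)
  | .op o e₁ e₂ => o.eval (e₁.eval s) (e₂.eval s)

/-- Time to evaluate an expression. -/
def RamExpr.cost (s : RamState) : RamExpr → ℕ
  | .const z => 1 + bitLength z
  | .read a e => e.cost s + 1 + bitLength (e.eval s) + bitLength (s a (e.eval s))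
  | .op _ e₁ e₂ => e₁.cost s + e₂.cost s +
      (1 + bitLength (e₁.eval s)) * (1 + bitLength (e₂.eval s))

inductive RamProgram
  | skip
  /-- store the value of `e` in the cell of array `a` whose index is the value of `idx` -/
  | assign (a : ℕ) (idx e : RamExpr)
  | seq (p q : RamProgram)
  /-- run `p` if the value of `e` is positive, and `q` otherwise -/
  | ifPos (e : RamExpr) (p q : RamProgram)
  /-- run `p` as long as the value of `e` is positive -/
  | whilePos (e : RamExpr) (p : RamProgram)

def RamState.store (s : RamState) (a : ℕ) (i z : ℤ) : RamState :=
  fun b j => if b = a ∧ j = i then z else s b j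

/-- `Runs p s t s'`: the program `p`, started in `s`, halts in `s'` after time `t`. -/
inductive Runs : RamProgram → RamState → ℕ → RamState → Prop
  | skip (s : RamState) : Runs .skip s 1 s
  | assign (a : ℕ) (idx e : RamExpr) (s : RamState) :
      Runs (.assign a idx e) s
        (idx.cost s + e.cost s + 1 + bitLength (idx.eval s) + bitLength (e.eval s))
        (s.store a (idx.eval s) (e.eval s))
  | seq {p q : RamProgram} {s s' s'' : RamState} {t t' : ℕ} :
      Runs p s t s' → Runs q s' t' s'' → Runs (.seq p q) s (t + t') s''
  | ifPos_pos {e : RamExpr} {p q : RamProgram} {s s' : RamState} {t : ℕ} :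
      0 < e.eval s → Runs p s t s' → Runs (.ifPos e p q) s (e.cost s + t) s'
  | ifPos_neg {e : RamExpr} {p q : RamProgram} {s s' : RamState} {t : ℕ} :
      ¬ 0 < e.eval s → Runs q s t s' → Runs (.ifPos e p q) s (e.cost s + t) s'
  | while_done {e : RamExpr} {p : RamProgram} {s : RamState} :
      ¬ 0 < e.eval s → Runs (.whilePos e p) s (e.cost s) s
  | while_step {e : RamExpr} {p : RamProgram} {s s' s'' : RamState} {t t' : ℕ} :
      0 < e.eval s → Runs p s t s' → Runs (.whilePos e p) s' t' s'' →
      Runs (.whilePos e p) s (e.cost s + t + t') s''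

/-- The table of `f` at the allowed triples, as the content of an array. -/
def tableOf (n : ℕ) (f : Finset (Fin n) → Finset (Fin n) → Finset (Fin n) → ℤ) : ℤ → ℤ :=
  fun i => if 0 ≤ i ∧ i < 6 ^ n then f (rowA n i.toNat) (rowB n i.toNat) (rowC n i.toNat) else 0

/-- Input: `n` in cell `0` of array `0`, the table of `f` in array `1`, the table of `g` in
array `2`; all other cells are zero. -/
def inputState (n : ℕ) (f g : Finset (Fin n) → Finset (Fin n) → Finset (Fin n) → ℤ) : RamState :=
  fun a i => if a = 0 ∧ i = 0 then (n : ℤ) else if a = 1 then tableOf n f i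
    else if a = 2 then tableOf n g i else 0

/-- Output: array `3` holds the values of `h` at all allowed triples. -/
def IsOutput (n : ℕ) (h : Finset (Fin n) → Finset (Fin n) → Finset (Fin n) → ℤ)
    (s : RamState) : Prop :=
  ∀ i : ℕ, i < 6 ^ n → s 3 (i : ℤ) = h (rowA n i) (rowB n i) (rowC n i)

/-! ### The matrix multiplication exponent -/

/-- The polynomial `q` is available without further operations after the first `i` steps
`p 0, …, p (i-1)`: it is a constant, a variable, or one of these results. -/
def IsAvailable {V : Type*} (p : ℕ → MvPolynomial V ℚ) (i : ℕ) (q : MvPolynomial V ℚ) : Prop :=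
  (∃ c : ℚ, q = MvPolynomial.C c) ∨ (∃ v : V, q = MvPolynomial.X v) ∨ ∃ j < i, q = p j

/-- `p 0, …, p (r-1)` is a straight-line computation: each `p i` is the sum, difference or product
of two polynomials that are available at step `i`. -/
def IsStraightLine {V : Type*} (p : ℕ → MvPolynomial V ℚ) (r : ℕ) : Prop :=
  ∀ i < r, ∃ q₁ q₂ : MvPolynomial V ℚ, IsAvailable p i q₁ ∧ IsAvailable p i q₂ ∧
    (p i = q₁ + q₂ ∨ p i = q₁ - q₂ ∨ p i = q₁ * q₂)

/-- Two `m × m` matrices over `ℚ` can be multiplied with `r` arithmetic operations. The variables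
`Sum.inl (i, j)` and `Sum.inr (i, j)` are the entries of the first and of the second matrix. -/
def MatMulWith (m r : ℕ) : Prop :=
  ∃ p : ℕ → MvPolynomial ((Fin m × Fin m) ⊕ (Fin m × Fin m)) ℚ, IsStraightLine p r ∧
    ∀ i j : Fin m, IsAvailable p r
      (∑ k : Fin m, MvPolynomial.X (Sum.inl (i, k)) * MvPolynomial.X (Sum.inr (k, j)))

/-- `ω`: the infimum of all real `τ` such that `m × m` matrices can be multiplied with `O(m ^ τ)`
arithmetic operations. -/
noncomputable def matMulExponent : ℝ :=
  sInf {τ : ℝ | ∃ K : ℝ, ∀ m : ℕ, 1 ≤ m → ∃ r : ℕ, (r : ℝ) ≤ K * (m : ℝ) ^ τ ∧ MatMulWith m r}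

/-! Coded as words over six states, the allowed triples turn the signed join into a trilinear tensor
`joinTensor`, and the time is governed by the rank of this tensor on words of a fixed length `s`.

At a single vertex the join is graded by `stateDeg`. Up to a sign it is the top-degree part of a
filtered algebra isomorphic to `M₂(ℚ) ⊕ ℚ ⊕ ℚ` (`stateMul_eq`, `stateMul_eq_zero`). The `s`-th
tensor power of that algebra is a direct sum of matrix algebras, so `O(m ^ τ)` matrix multiplication
gives it rank `O((2 ^ τ + 2) ^ s)` (`MatMulWith.hasRank`, `hasRank_prod_unitMul`). Extracting the
top degree only requires fixing the degrees of the two factors, a loss polynomial in `s`.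

Modulo two, the exponent of the sign is a bilinear count of inversions. By `sgn_join` it splits into
functions of one word each, which do not affect the rank; a product of two global parities, which
costs a factor two; a sign at each vertex, which is exactly the one produced by the filtered
algebra; and the inversions between the parities of `B + C`. The last part again becomes a sum of
functions of single words in the basis of matrix units, because the parity of `e_ij` is a row value
plus a column value (`prod_unitMul_mul_sgn`).

For `s` large, the slack `ε` absorbs all constant and polynomial factors
(`exists_blockDecomposition`). Longer words are cut into blocks and treated by Yates' algorithm, one
block at a time. The sign between blocks depends only on parities (`wordTensor_add`), so a
four-valued bond carried along the transform of the first factor accounts for it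
(`BlockDecomposition.sum_kernel`). Denominators are cleared beforehand and divided out at the end;
all numbers keep `O(n + L)` bits, hence the logarithmic cost adds only polynomial factors. -/

open Finset

/-! ### Rank of trilinear tensors over `ℚ` -/

/-- The tensor `τ` is a sum of `R` products of linear forms. -/
def HasRank {α β γ : Type*} (τ : α → β → γ → ℚ) (R : ℕ) : Prop :=
  ∃ (u : ℕ → α → ℚ) (v : ℕ → β → ℚ) (w : ℕ → γ → ℚ),
    ∀ a b c, τ a b c = ∑ ρ ∈ range R, u ρ a * v ρ b * w ρ c

theorem HasRank.of_fintype {α β γ κ : Type*} [Fintype κ] {τ : α → β → γ → ℚ}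
    (u : κ → α → ℚ) (v : κ → β → ℚ) (w : κ → γ → ℚ)
    (h : ∀ a b c, τ a b c = ∑ ρ, u ρ a * v ρ b * w ρ c) : HasRank τ (Fintype.card κ) := by
  classical
  let e := Fintype.equivFin κ
  refine ⟨fun n a => if h : n < Fintype.card κ then u (e.symm ⟨n, h⟩) a else 0,
    fun n a => if h : n < Fintype.card κ then v (e.symm ⟨n, h⟩) a else 0,
    fun n a => if h : n < Fintype.card κ then w (e.symm ⟨n, h⟩) a else 0, fun a b c => ?_⟩
  rw [h, Finset.sum_range, ← e.symm.sum_comp]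
  simp

theorem HasRank.mono {α β γ : Type*} {τ : α → β → γ → ℚ} {R R' : ℕ} (h : HasRank τ R)
    (hR : R ≤ R') : HasRank τ R' := by
  obtain ⟨u, v, w, h⟩ := h
  refine ⟨fun n a => if n < R then u n a else 0, v, w, fun a b c => ?_⟩
  rw [h, ← Finset.sum_subset (Finset.range_subset_range.2 hR)]
  · exact Finset.sum_congr rfl fun i hi => by simp [Finset.mem_range.1 hi]
  · intro i _ hi
    simp [Finset.mem_range.not.1 hi]

theorem HasRank.sum {α β γ ι : Type*} [Fintype ι] {τ : ι → α → β → γ → ℚ} {R : ι → ℕ}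
    (h : ∀ i, HasRank (τ i) (R i)) :
    HasRank (fun a b c => ∑ i, τ i a b c) (∑ i, R i) := by
  choose u v w h using h
  have := HasRank.of_fintype (κ := Σ i, Fin (R i)) (τ := fun a b c => ∑ i, τ i a b c)
    (fun k => u k.1 k.2) (fun k => v k.1 k.2) (fun k => w k.1 k.2) (fun a b c => by
      rw [Fintype.sum_sigma]
      refine Finset.sum_congr rfl fun i _ => ?_
      rw [h, Finset.sum_range])
  simpa using this

/-- Precomposition with linear maps, given by matrices, does not increase the rank. -/
theorem HasRank.pullback {α β γ α' β' γ' : Type*} [Fintype α'] [Fintype β'] [Fintype γ']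
    {τ : α' → β' → γ' → ℚ} {R : ℕ} (h : HasRank τ R)
    (F : α → α' → ℚ) (G : β → β' → ℚ) (H : γ → γ' → ℚ) :
    HasRank (fun a b c => ∑ a', ∑ b', ∑ c', F a a' * G b b' * H c c' * τ a' b' c') R := by
  obtain ⟨u, v, w, h⟩ := h
  refine ⟨fun ρ a => ∑ a', F a a' * u ρ a', fun ρ b => ∑ b', G b b' * v ρ b',
    fun ρ c => ∑ c', H c c' * w ρ c', fun a b c => ?_⟩
  have : ∀ ρ, (∑ a', F a a' * u ρ a') * (∑ b', G b b' * v ρ b') * (∑ c', H c c' * w ρ c') =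
      ∑ a', ∑ b', ∑ c', F a a' * u ρ a' * (G b b' * v ρ b') * (H c c' * w ρ c') := by
    intro ρ
    rw [Finset.sum_mul_sum, Finset.sum_mul]
    refine Finset.sum_congr rfl fun a' _ => ?_
    rw [Finset.sum_mul]
    exact Finset.sum_congr rfl fun b' _ => by rw [Finset.mul_sum]
  rw [Finset.sum_congr rfl fun ρ _ => this ρ]
  simp only [h, Finset.mul_sum]
  symm
  rw [Finset.sum_comm]
  refine Finset.sum_congr rfl fun a' _ => ?_
  rw [Finset.sum_comm]
  refine Finset.sum_congr rfl fun b' _ => ?_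
  rw [Finset.sum_comm]
  exact Finset.sum_congr rfl fun c' _ => Finset.sum_congr rfl fun ρ _ => by ring

theorem HasRank.comp {α β γ α' β' γ' : Type*} {τ : α' → β' → γ' → ℚ} {R : ℕ}
    (h : HasRank τ R) (F : α → α') (G : β → β') (H : γ → γ') :
    HasRank (fun a b c => τ (F a) (G b) (H c)) R := by
  obtain ⟨u, v, w, h⟩ := h
  exact ⟨fun ρ a => u ρ (F a), fun ρ b => v ρ (G b), fun ρ c => w ρ (H c), fun a b c => h _ _ _⟩

theorem HasRank.diag {α β γ : Type*} {τ : α → β → γ → ℚ} {R : ℕ}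
    (h : HasRank τ R) (F : α → ℚ) (G : β → ℚ) (H : γ → ℚ) :
    HasRank (fun a b c => F a * G b * H c * τ a b c) R := by
  obtain ⟨u, v, w, h⟩ := h
  refine ⟨fun ρ a => F a * u ρ a, fun ρ b => G b * v ρ b, fun ρ c => H c * w ρ c,
    fun a b c => ?_⟩
  simp only [h, Finset.mul_sum]
  exact Finset.sum_congr rfl fun _ _ => by ring

/-! ### Matrix multiplication -/

/-- The tensor of the multiplication of matrices with rows and columns indexed by `I`. -/
def matMulTensor (I : Type*) [DecidableEq I] (a b c : I × I) : ℚ :=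
  if a.2 = b.1 ∧ a.1 = c.1 ∧ b.2 = c.2 then 1 else 0

/-! ### Bilinear parts of straight-line computations -/

section

open MvPolynomial

variable {V : Type*}

/-- The coefficient of the variable `v`. -/
noncomputable def linPart (v : V) (q : MvPolynomial V ℚ) : ℚ := eval 0 (pderiv v q)

/-- The second partial derivative in the variables `v`, `w` at the origin. -/
noncomputable def bilinPart (v w : V) (q : MvPolynomial V ℚ) : ℚ :=
  eval 0 (pderiv w (pderiv v q))

theorem bilinPart_mul (v w : V) (p q : MvPolynomial V ℚ) :
    bilinPart v w (p * q) = bilinPart v w p * eval 0 q + linPart v p * linPart w q +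
      linPart w p * linPart v q + eval 0 p * bilinPart v w q := by
  simp only [bilinPart, linPart, Derivation.leibniz, map_add, smul_eq_mul, map_mul]
  ring

theorem bilinPart_add (v w : V) (p q : MvPolynomial V ℚ) :
    bilinPart v w (p + q) = bilinPart v w p + bilinPart v w q := by simp [bilinPart]

theorem bilinPart_sub (v w : V) (p q : MvPolynomial V ℚ) :
    bilinPart v w (p - q) = bilinPart v w p - bilinPart v w q := by simp [bilinPart]

theorem bilinPart_C (v w : V) (c : ℚ) : bilinPart v w (C c) = 0 := by simp [bilinPart]

theorem linPart_X [DecidableEq V] (v x : V) : linPart v (X x) = if x = v then 1 else 0 := by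
  rw [linPart, pderiv_X]
  by_cases h : x = v
  · subst h; simp
  · simp [h]

theorem bilinPart_X (v w x : V) : bilinPart v w (X x) = 0 := by
  classical
  rw [bilinPart, pderiv_X]
  by_cases h : v = x
  · subst h; simp
  · simp [Ne.symm h]

/-- The bilinear parts of the results of a straight-line computation are combinations of the
products of the linear parts of the factors in its steps. -/
theorem IsStraightLine.exists_bilinPart {p : ℕ → MvPolynomial V ℚ} {r : ℕ}
    (h : IsStraightLine p r) :
    ∃ l₁ l₂ : ℕ → V → ℚ, ∀ q, IsAvailable p r q → ∃ α : ℕ → ℚ, ∀ v w,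
      bilinPart v w q = ∑ j ∈ range r, α j * (l₁ j v * l₂ j w + l₁ j w * l₂ j v) := by
  have h' : ∀ i, ∃ q₁ q₂ : MvPolynomial V ℚ, i < r → IsAvailable p i q₁ ∧ IsAvailable p i q₂ ∧
    (p i = q₁ + q₂ ∨ p i = q₁ - q₂ ∨ p i = q₁ * q₂) := by
    intro i
    by_cases hi : i < r
    · obtain ⟨q₁, q₂, hq⟩ := h i hi
      exact ⟨q₁, q₂, fun _ => hq⟩
    · exact ⟨0, 0, fun h => absurd h hi⟩
  choose q₁ q₂ hq using h'
  refine ⟨fun j v => linPart v (q₁ j), fun j v => linPart v (q₂ j), ?_⟩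
  have key : ∀ j < r, ∃ α : ℕ → ℚ, (∀ k, j < k → α k = 0) ∧ ∀ v w, bilinPart v w (p j) =
      ∑ j ∈ range r, α j * (linPart v (q₁ j) * linPart w (q₂ j) +
        linPart w (q₁ j) * linPart v (q₂ j)) := by
    intro j
    induction j using Nat.strong_induction_on with
    | _ j ih =>
      intro hj
      have avail : ∀ q, IsAvailable p j q → ∃ α : ℕ → ℚ, (∀ k, j ≤ k → α k = 0) ∧
          ∀ v w, bilinPart v w q = ∑ j ∈ range r, α j * (linPart v (q₁ j) * linPart w (q₂ j) +
            linPart w (q₁ j) * linPart v (q₂ j)) := by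
        rintro q (⟨c, rfl⟩ | ⟨x, rfl⟩ | ⟨i, hi, rfl⟩)
        · exact ⟨0, by simp, fun v w => by simp [bilinPart_C]⟩
        · exact ⟨0, by simp, fun v w => by simp [bilinPart_X]⟩
        · obtain ⟨α, hα, h⟩ := ih i hi (hi.trans hj)
          exact ⟨α, fun k hk => hα k (by omega), h⟩
      obtain ⟨h1, h2, h3⟩ := hq j hj
      obtain ⟨α, hα, hα'⟩ := avail _ h1
      obtain ⟨β, hβ, hβ'⟩ := avail _ h2
      rcases h3 with h3 | h3 | h3
      · refine ⟨α + β, fun k hk => by simp [hα k hk.le, hβ k hk.le], fun v w => ?_⟩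
        simp [h3, bilinPart_add, hα', hβ', add_mul, Finset.sum_add_distrib]
      · refine ⟨α - β, fun k hk => by simp [hα k hk.le, hβ k hk.le], fun v w => ?_⟩
        simp [h3, bilinPart_sub, hα', hβ', sub_mul, Finset.sum_sub_distrib]
      -- By the Leibniz rule the old combinations are scaled by the values of the factors at the
      -- origin, and the product formed in step `j` enters with coefficient one.
      · refine ⟨fun k => eval 0 (q₂ j) * α k + eval 0 (q₁ j) * β k + if k = j then 1 else 0,
          fun k hk => by simp [hα k hk.le, hβ k hk.le, hk.ne'], fun v w => ?_⟩
        simp only [add_mul, Finset.sum_add_distrib, mul_assoc, ← Finset.mul_sum, ← hα', ← hβ', h3,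
          bilinPart_mul, ite_mul, zero_mul, one_mul, Finset.sum_ite_eq', Finset.mem_range, hj,
          if_true]
        ring
  rintro q (⟨c, rfl⟩ | ⟨x, rfl⟩ | ⟨i, hi, rfl⟩)
  · exact ⟨0, fun v w => by simp [bilinPart_C]⟩
  · exact ⟨0, fun v w => by simp [bilinPart_X]⟩
  · obtain ⟨α, -, h⟩ := key i hi
    exact ⟨α, h⟩

theorem bilinPart_matMul {m : ℕ} (a b : Fin m × Fin m) (i j : Fin m) :
    bilinPart (Sum.inl a) (Sum.inr b)
      (∑ k : Fin m, (X (Sum.inl (i, k)) * X (Sum.inr (k, j)) :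
        MvPolynomial ((Fin m × Fin m) ⊕ (Fin m × Fin m)) ℚ)) = matMulTensor (Fin m) a b (i, j) := by
  have : ∀ k : Fin m, bilinPart (Sum.inl a) (Sum.inr b)
      (X (Sum.inl (i, k)) * X (Sum.inr (k, j)) :
        MvPolynomial ((Fin m × Fin m) ⊕ (Fin m × Fin m)) ℚ) =
      if k = a.2 then (if a.2 = b.1 ∧ a.1 = i ∧ b.2 = j then 1 else 0) else 0 := by
    intro k
    rw [bilinPart_mul]
    simp only [linPart_X, bilinPart_X]
    obtain ⟨a1, a2⟩ := a
    obtain ⟨b1, b2⟩ := b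
    simp only [Sum.inl.injEq, Sum.inr.injEq, Prod.mk.injEq]
    by_cases h1 : i = a1 <;> by_cases h2 : k = a2 <;> by_cases h3 : k = b1 <;>
      by_cases h4 : j = b2 <;> simp_all [eq_comm]
  have hs : ∀ s : Finset (Fin m), bilinPart (Sum.inl a) (Sum.inr b)
      (∑ k ∈ s, (X (Sum.inl (i, k)) * X (Sum.inr (k, j)) :
        MvPolynomial ((Fin m × Fin m) ⊕ (Fin m × Fin m)) ℚ)) =
      ∑ k ∈ s, bilinPart (Sum.inl a) (Sum.inr b)
      (X (Sum.inl (i, k)) * X (Sum.inr (k, j)) :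
        MvPolynomial ((Fin m × Fin m) ⊕ (Fin m × Fin m)) ℚ) := by
    intro s; simp [bilinPart, map_sum]
  rw [hs, Finset.sum_congr rfl fun k _ => this k]
  simp [matMulTensor]

/-- Only second derivatives in one entry of each matrix matter. A step contributes a symmetrized
product of two linear forms, that is, two rank-one terms; this is the factor two. -/
theorem MatMulWith.hasRank {m r : ℕ} (h : MatMulWith m r) :
    HasRank (matMulTensor (Fin m)) (2 * r) := by
  obtain ⟨p, hp, hout⟩ := h
  obtain ⟨l₁, l₂, hl⟩ := hp.exists_bilinPart
  choose α hα using fun i j => hl _ (hout i j)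
  have := HasRank.of_fintype (κ := Fin r × Bool) (τ := matMulTensor (Fin m))
    (fun k a => if k.2 then l₁ k.1 (Sum.inl a) else l₂ k.1 (Sum.inl a))
    (fun k b => if k.2 then l₂ k.1 (Sum.inr b) else l₁ k.1 (Sum.inr b))
    (fun k c => α c.1 c.2 k.1) (fun a b c => by
      rw [show c = (c.1, c.2) from rfl, ← bilinPart_matMul, hα, Fintype.sum_prod_type,
        Finset.sum_range]
      refine Finset.sum_congr rfl fun i _ => ?_
      simp
      ring)
  simpa [mul_comm] using this

/-- The bilinear part in the entries `(i, 0)` and `(0, j)` is one for the output at `(i, j)` and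
zero for every other output, for a constant and for a variable. So each output needs a step of its
own. -/
theorem MatMulWith.sq_le {m r : ℕ} (h : MatMulWith m r) : m ^ 2 ≤ r := by
  rcases Nat.eq_zero_or_pos m with rfl | hm
  · simp
  obtain ⟨p, hp, hout⟩ := h
  have h1 : ∀ c : Fin m × Fin m, ∃ t : Fin r,
      (∑ k : Fin m, (X (Sum.inl (c.1, k)) * X (Sum.inr (k, c.2)) :
        MvPolynomial ((Fin m × Fin m) ⊕ (Fin m × Fin m)) ℚ)) = p t := by
    rintro ⟨i, j⟩
    have hb := bilinPart_matMul (i, ⟨0, hm⟩) (⟨0, hm⟩, j) i j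
    rcases hout i j with ⟨c, hc⟩ | ⟨x, hx⟩ | ⟨t, ht, h⟩
    · rw [hc, bilinPart_C] at hb
      simp [matMulTensor] at hb
    · rw [hx, bilinPart_X] at hb
      simp [matMulTensor] at hb
    · exact ⟨⟨t, ht⟩, h⟩
  choose t ht using h1
  have hinj : Function.Injective t := by
    rintro ⟨i, j⟩ ⟨i', j'⟩ he
    have hb := bilinPart_matMul (i, ⟨0, hm⟩) (⟨0, hm⟩, j) i j
    have hb' := bilinPart_matMul (i, ⟨0, hm⟩) (⟨0, hm⟩, j) i' j'
    have e1 := ht (i, j)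
    have e2 := ht (i', j')
    rw [he, ← e2] at e1
    simp only at e1
    rw [e1, hb'] at hb
    by_contra hne
    simp only [matMulTensor] at hb
    rw [if_neg, if_pos] at hb
    · simp at hb
    · simp
    · rintro ⟨-, h1, h2⟩
      exact hne (by simp_all)
  have := Fintype.card_le_of_injective t hinj
  simpa [sq] using this

theorem IsStraightLine.extend {p : ℕ → MvPolynomial V ℚ} {r : ℕ} (h : IsStraightLine p r)
    {q₁ q₂ q : MvPolynomial V ℚ} (h₁ : IsAvailable p r q₁) (h₂ : IsAvailable p r q₂)
    (hq : q = q₁ + q₂ ∨ q = q₁ - q₂ ∨ q = q₁ * q₂) :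
    ∃ p', IsStraightLine p' (r + 1) ∧ IsAvailable p' (r + 1) q ∧
      ∀ q', IsAvailable p r q' → IsAvailable p' (r + 1) q' := by
  have agree : ∀ {i}, i ≤ r → ∀ {q'}, IsAvailable p i q' →
      IsAvailable (Function.update p r q) i q' := by
    rintro i hi q' (h | h | ⟨j, hj, h⟩)
    · exact Or.inl h
    · exact Or.inr (Or.inl h)
    · exact Or.inr (Or.inr ⟨j, hj, by rw [h, Function.update_of_ne (by omega)]⟩)
  refine ⟨Function.update p r q, ?_, Or.inr (Or.inr ⟨r, by omega, by simp⟩), ?_⟩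
  · intro i hi
    rcases Nat.lt_succ_iff_lt_or_eq.1 hi with hi | rfl
    · obtain ⟨a, b, ha, hb, hab⟩ := h i hi
      exact ⟨a, b, agree hi.le ha, agree hi.le hb, by rwa [Function.update_of_ne hi.ne]⟩
    · exact ⟨q₁, q₂, agree le_rfl h₁, agree le_rfl h₂, by simpa using hq⟩
  · intro q' hq'
    rcases agree le_rfl hq' with h | h | ⟨j, hj, h⟩
    · exact Or.inl h
    · exact Or.inr (Or.inl h)
    · exact Or.inr (Or.inr ⟨j, by omega, h⟩)

/-- The schoolbook algorithm. -/
theorem matMulWith_cube (m : ℕ) : MatMulWith m (2 * m ^ 3) := by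
  let T : Type := (Fin m × Fin m) ⊕ (Fin m × Fin m)
  let Y : Fin m × Fin m → Fin m → MvPolynomial T ℚ :=
    fun c k => X (Sum.inl (c.1, k)) * X (Sum.inr (k, c.2))
  -- Each summand takes one multiplication and one addition, hence `2 * s.card` further steps.
  have entry : ∀ (p : ℕ → MvPolynomial T ℚ) (r : ℕ) (c : Fin m × Fin m) (s : Finset (Fin m)),
      IsStraightLine p r → ∃ p', IsStraightLine p' (r + 2 * s.card) ∧
        IsAvailable p' (r + 2 * s.card) (∑ k ∈ s, Y c k) ∧
        ∀ q', IsAvailable p r q' → IsAvailable p' (r + 2 * s.card) q' := by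
    intro p r c s hp
    induction s using Finset.induction_on with
    | empty => exact ⟨p, hp, Or.inl ⟨0, by simp⟩, fun _ h => h⟩
    | insert k s hk ih =>
      obtain ⟨p1, hp1, ha1, hb1⟩ := ih
      obtain ⟨p2, hp2, ha2, hb2⟩ := hp1.extend (q := Y c k)
        (Or.inr (Or.inl ⟨Sum.inl (c.1, k), rfl⟩)) (Or.inr (Or.inl ⟨Sum.inr (k, c.2), rfl⟩))
        (Or.inr (Or.inr rfl))
      obtain ⟨p3, hp3, ha3, hb3⟩ := hp2.extend ha2 (hb2 _ ha1) (Or.inl rfl)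
      rw [Finset.card_insert_of_notMem hk, Finset.sum_insert hk, Nat.mul_succ, ← add_assoc]
      exact ⟨p3, hp3, ha3, fun q hq => hb3 _ (hb2 _ (hb1 _ hq))⟩
  have all : ∀ s : Finset (Fin m × Fin m), ∃ p, IsStraightLine p (s.card * (2 * m)) ∧
      ∀ c ∈ s, IsAvailable p (s.card * (2 * m)) (∑ k, Y c k) := by
    intro s
    induction s using Finset.induction_on with
    | empty => exact ⟨0, fun i hi => by simp at hi, by simp⟩
    | insert c s hc ih =>
      obtain ⟨p, hp, ha⟩ := ih
      obtain ⟨p', hp', ha', hb'⟩ := entry p _ c univ hp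
      rw [Finset.card_univ, Fintype.card_fin] at hp' ha' hb'
      rw [Finset.card_insert_of_notMem hc, Nat.succ_mul]
      refine ⟨p', hp', fun d hd => ?_⟩
      rcases Finset.mem_insert.1 hd with rfl | hd
      · exact ha'
      · exact hb' _ (ha d hd)
  obtain ⟨p, hp, ha⟩ := all univ
  have hc : (univ : Finset (Fin m × Fin m)).card * (2 * m) = 2 * m ^ 3 := by
    simp; ring
  rw [hc] at hp ha
  exact ⟨p, hp, fun i j => ha (i, j) (Finset.mem_univ _)⟩

end

/-! ### Bounds for the exponent -/

theorem two_le_of_matMul {τ K : ℝ}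
    (h : ∀ m : ℕ, 1 ≤ m → ∃ r : ℕ, (r : ℝ) ≤ K * (m : ℝ) ^ τ ∧ MatMulWith m r) : 2 ≤ τ := by
  by_contra hτ
  push Not at hτ
  have h1 : ∀ m : ℕ, 1 ≤ m → (m : ℝ) ^ (2 - τ) ≤ K := by
    intro m hm
    obtain ⟨r, hr, hr'⟩ := h m hm
    have h2 : ((m : ℝ)) ^ 2 ≤ r := by exact_mod_cast hr'.sq_le
    have hm' : (0 : ℝ) < m := by exact_mod_cast hm
    rw [Real.rpow_sub hm', div_le_iff₀ (Real.rpow_pos_of_pos hm' _)]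
    simpa using h2.trans hr
  have h2 := (tendsto_rpow_atTop (sub_pos.2 hτ)).comp (tendsto_natCast_atTop_atTop (R := ℝ))
  obtain ⟨m, hm, hm'⟩ := ((h2.eventually_gt_atTop K).and (Filter.eventually_ge_atTop 1)).exists
  exact absurd (h1 m hm') (not_le.2 hm)

/-- The infimum need not be attained, so a little room `δ` is given away; the schoolbook algorithm
shows that it is taken over a nonempty set. -/
theorem exists_matMul_lt {δ : ℝ} (hδ : 0 < δ) :
    ∃ τ K : ℝ, τ < matMulExponent + δ ∧
      ∀ m : ℕ, 1 ≤ m → ∃ r : ℕ, (r : ℝ) ≤ K * (m : ℝ) ^ τ ∧ MatMulWith m r := by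
  have hne : {τ : ℝ | ∃ K : ℝ, ∀ m : ℕ, 1 ≤ m →
      ∃ r : ℕ, (r : ℝ) ≤ K * (m : ℝ) ^ τ ∧ MatMulWith m r}.Nonempty :=
    ⟨(3 : ℕ), 2, fun m _ => ⟨2 * m ^ 3, by rw [Real.rpow_natCast]; push_cast; rfl, matMulWith_cube m⟩⟩
  obtain ⟨τ, ⟨K, hK⟩, hτ⟩ := exists_lt_of_csInf_lt hne
    (show matMulExponent < matMulExponent + δ by linarith)
  exact ⟨τ, K, hτ, hK⟩

/-- Needed to make the base `2 ^ (ω + δ) + 2` exceed six, so that the tables themselves are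
affordable. -/
theorem two_le_matMulExponent : 2 ≤ matMulExponent := by
  refine le_csInf ⟨(3 : ℕ), 2, fun m _ => ⟨2 * m ^ 3, ?_, matMulWith_cube m⟩⟩ ?_
  · rw [Real.rpow_natCast]; push_cast; rfl
  · rintro τ ⟨K, hK⟩
    exact two_le_of_matMul hK

/-! ### Signs and inversions -/

/-- `sgn z = (-1) ^ z`. -/
def sgn (z : ZMod 2) : ℤ := if z = 0 then 1 else -1

theorem sgn_zero : sgn 0 = 1 := rfl

theorem sgn_add (a b : ZMod 2) : sgn (a + b) = sgn a * sgn b := by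
  revert a b; decide

theorem sgn_sum {ι : Type*} (s : Finset ι) (f : ι → ZMod 2) :
    sgn (∑ i ∈ s, f i) = ∏ i ∈ s, sgn (f i) := by
  classical
  induction s using Finset.induction_on with
  | empty => rfl
  | insert a s ha ih => rw [Finset.sum_insert ha, Finset.prod_insert ha, sgn_add, ih]

theorem sgn_natCast (k : ℕ) : sgn (k : ZMod 2) = (-1) ^ k := by
  induction k with
  | zero => rfl
  | succ k ih =>
    rw [Nat.cast_succ, sgn_add, ih, pow_succ]
    rfl

/-- The number of inversions, modulo two, between two subsets given by indicator functions. -/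
def inversions {n : ℕ} (φ ψ : Fin n → ZMod 2) : ZMod 2 :=
  ∑ v, ∑ w, (if w < v then 1 else 0) * (φ v * ψ w)

theorem inversions_add_left {n : ℕ} (φ φ' ψ : Fin n → ZMod 2) :
    inversions (fun v => φ v + φ' v) ψ = inversions φ ψ + inversions φ' ψ := by
  simp only [inversions, ← Finset.sum_add_distrib]
  exact Finset.sum_congr rfl fun _ _ => Finset.sum_congr rfl fun _ _ => by ring

theorem inversions_add_right {n : ℕ} (φ ψ ψ' : Fin n → ZMod 2) :
    inversions φ (fun v => ψ v + ψ' v) = inversions φ ψ + inversions φ ψ' := by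
  simp only [inversions, ← Finset.sum_add_distrib]
  exact Finset.sum_congr rfl fun _ _ => Finset.sum_congr rfl fun _ _ => by ring

/-- A pair `(v, w)` lies below, above or on the diagonal, and the three sums fill the whole square.
This trades an order-dependent sign for a product of global parities and a sign at each vertex. -/
theorem inversions_add_swap {n : ℕ} (φ ψ : Fin n → ZMod 2) :
    inversions φ ψ + inversions ψ φ + ∑ v, φ v * ψ v = (∑ v, φ v) * ∑ v, ψ v := by
  have h1 : inversions ψ φ = ∑ v, ∑ w, (if v < w then 1 else 0) * (φ v * ψ w) := by
    rw [inversions, Finset.sum_comm]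
    exact Finset.sum_congr rfl fun _ _ => Finset.sum_congr rfl fun _ _ => by ring
  have h2 : ∑ v, φ v * ψ v = ∑ v, ∑ w, (if v = w then 1 else 0) * (φ v * ψ w) := by
    simp
  rw [h1, h2, Finset.sum_mul_sum]
  simp only [inversions, ← Finset.sum_add_distrib]
  refine Finset.sum_congr rfl fun v _ => Finset.sum_congr rfl fun w _ => ?_
  rcases lt_trichotomy v w with h | h | h
  · simp [h, h.not_gt, h.ne]
  · simp [h]
  · simp [h, h.not_gt, h.ne']

theorem zmod_two_add_self (a : ZMod 2) : a + a = 0 := by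
  revert a; decide

/-! ### The six states and the structure tensor of the join -/

def natA : Fin 6 → ℕ := ![0, 1, 1, 0, 0, 1]
def natB : Fin 6 → ℕ := ![0, 0, 0, 1, 1, 1]
def natC : Fin 6 → ℕ := ![0, 0, 1, 0, 1, 1]
def bitB (d : Fin 6) : ZMod 2 := natB d
def bitC (d : Fin 6) : ZMod 2 := natC d

/-- The state `c` is the disjoint union of `a` and `b`. -/
def stateJoin (a b c : Fin 6) : ℤ :=
  if natA a + natA b = natA c ∧ natB a + natB b = natB c ∧ natC a + natC b = natC c then 1 else 0

def stateDeg : Fin 6 → ℕ := ![0, 1, 1, 1, 1, 2]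

/-- The structure constants of the signed join of words over the six states. -/
def joinTensor {n : ℕ} (x y z : Fin n → Fin 6) : ℤ :=
  (∏ v, stateJoin (x v) (y v) (z v)) *
    sgn (inversions (fun v => bitB (x v)) (fun v => bitB (y v)) +
      inversions (fun v => bitC (x v)) (fun v => bitC (y v)))

/-! ### The filtered algebra `M₂(ℚ) ⊕ ℚ ⊕ ℚ`

Its units are `e₁₁, e₁₂, e₂₁, e₂₂` and two further idempotents. -/

/-- Type `0` is the matrix block. The types `1` and `2` are the one-dimensional blocks, whose row
and column are set to `0` by convention. -/
def unitType : Fin 6 → Fin 3 := ![0, 0, 0, 0, 1, 2]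
def unitRow : Fin 6 → Fin 2 := ![0, 0, 1, 1, 0, 0]
def unitCol : Fin 6 → Fin 2 := ![0, 1, 0, 1, 0, 0]

def unitMul (u v w : Fin 6) : ℤ :=
  if unitType u = unitType v ∧ unitType u = unitType w ∧ unitCol u = unitRow v ∧
    unitRow u = unitRow w ∧ unitCol v = unitCol w then 1 else 0

/-- Coordinates of the states in the basis of the units. -/
def toUnit : Fin 6 → Fin 6 → ℤ :=
  ![![1, 0, 0, 1, 1, 1], ![1, 0, 0, 1, 0, 0], ![0, 1, 0, 0, 0, 0], ![0, 0, 1, 0, 0, 0],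
    ![0, 0, 0, 1, 0, 1], ![0, 0, 0, 1, 0, 0]]

/-- `ofUnit c u` is the coordinate of the unit `u` at the state `c`. -/
def ofUnit : Fin 6 → Fin 6 → ℤ :=
  ![![0, 0, 0, 0, 1, 0], ![1, 0, 0, 0, -1, 0], ![0, 1, 0, 0, 0, 0], ![0, 0, 1, 0, 0, 0],
    ![0, 0, 0, 0, -1, 1], ![-1, 0, 0, 1, 1, -1]]

/-- The structure constants of the filtered algebra in the basis of the states. -/
def stateMul (a b c : Fin 6) : ℤ :=
  ∑ u, ∑ v, ∑ w, toUnit a u * toUnit b v * ofUnit c w * unitMul u v w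

def stateParity (d : Fin 6) : ZMod 2 := bitB d + bitC d
def unitParity : Fin 6 → ZMod 2 := ![0, 1, 1, 0, 0, 0]
-- Marks the first row of the matrix block. The parity of `e_ij` is the mark of row `i` plus the
-- mark of row `j`, which makes the parity sign a coboundary.
def unitZeta : Fin 6 → ZMod 2 := ![1, 1, 0, 0, 0, 0]

-- Apart from joins with the empty state, the identity of the algebra, the only joins are `1 + 4 =
-- 5` and `2 + 3 = 5`. Here `e₂₁ e₁₂ = e₂₂` is the state `5`, whereas `e₁₂ e₂₁ = e₁₁` is the state
-- `1` minus the state `5`: this is where the sign comes from.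
set_option maxRecDepth 100000 in
theorem stateMul_eq (a b c : Fin 6) (h : stateDeg c = stateDeg a + stateDeg b) :
    stateMul a b c = stateJoin a b c * sgn (bitC a * bitB b) := by
  revert a b c; decide +kernel

-- The empty state is the identity, and two nonempty states have total degree at least two, the
-- largest degree there is; so multiplication respects the filtration.
set_option maxRecDepth 100000 in
theorem stateMul_eq_zero (a b c : Fin 6) (h : stateDeg a + stateDeg b < stateDeg c) :
    stateMul a b c = 0 := by
  revert a b c; decide +kernel

theorem of_stateJoin_ne_zero (a b c : Fin 6) (h : stateJoin a b c ≠ 0) :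
    stateJoin a b c = 1 ∧ stateDeg c = stateDeg a + stateDeg b ∧ bitB c = bitB a + bitB b ∧
      bitC c = bitC a + bitC b := by
  revert a b c; decide +kernel

theorem parity_of_toUnit_ne_zero (a u : Fin 6) (h : toUnit a u ≠ 0) :
    stateParity a = unitParity u := by
  revert a u; decide +kernel

theorem of_unitMul_ne_zero (u v w : Fin 6) (h : unitMul u v w ≠ 0) :
    unitParity w = unitParity u + unitParity v ∧ unitZeta w = unitZeta u ∧
      unitParity u = unitZeta u + unitZeta v := by
  revert u v w; decide +kernel

/-! ### The rank of the structure tensor of the join -/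

theorem HasRank.matMulTensor_fintype {I : Type*} [Fintype I] [DecidableEq I] {r : ℕ}
    (h : MatMulWith (Fintype.card I) r) : HasRank (matMulTensor I) (2 * r) := by
  let e := Fintype.equivFin I
  have := h.hasRank.comp (fun a : I × I => (e a.1, e a.2)) (fun a : I × I => (e a.1, e a.2))
    (fun a : I × I => (e a.1, e a.2))
  convert this using 4
  simp [matMulTensor, e]

/-- A tensor power of a direct sum splits by the pattern `P` of the blocks chosen at each position.
The positions in the matrix block combine to one Kronecker power of `2 × 2` matrix multiplication,
which is again matrix multiplication. -/
theorem prod_unitMul {s : ℕ} (x y z : Fin s → Fin 6) :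
    ((∏ v, unitMul (x v) (y v) (z v) : ℤ) : ℚ) = ∑ P : Fin s → Fin 3,
      (if unitType ∘ x = P then 1 else 0) * (if unitType ∘ y = P then 1 else 0) *
      (if unitType ∘ z = P then 1 else 0) *
      matMulTensor ({v // P v = 0} → Fin 2)
        (fun v => unitRow (x v), fun v => unitCol (x v))
        (fun v => unitRow (y v), fun v => unitCol (y v))
        (fun v => unitRow (z v), fun v => unitCol (z v)) := by
  rw [Finset.sum_eq_single (unitType ∘ x) (fun P _ hP => by rw [if_neg (Ne.symm hP)]; simp)
    (by simp)]
  -- Outside the matrix block rows and columns are all zero, so the index conditions there hold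
  -- automatically.
  have h0 : ∀ u, unitType u ≠ 0 → unitRow u = 0 ∧ unitCol u = 0 := by decide
  have h1 : (∏ v, unitMul (x v) (y v) (z v)) = if ∀ v ∈ univ, unitType (x v) = unitType (y v) ∧
      unitType (x v) = unitType (z v) ∧ unitCol (x v) = unitRow (y v) ∧
      unitRow (x v) = unitRow (z v) ∧ unitCol (y v) = unitCol (z v) then 1 else 0 := by
    split_ifs with hh
    · exact Finset.prod_eq_one fun v hv => if_pos (hh v hv)
    · push Not at hh
      obtain ⟨v, hv, hh⟩ := hh
      exact Finset.prod_eq_zero hv (if_neg fun h => hh h.1 h.2.1 h.2.2.1 h.2.2.2.1 h.2.2.2.2)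
  rw [h1]
  by_cases hy : unitType ∘ y = unitType ∘ x
  · by_cases hz : unitType ∘ z = unitType ∘ x
    · simp only [hy, hz, if_true, one_mul, matMulTensor, Finset.mem_univ, true_imp_iff,
        Int.cast_ite, Int.cast_one, Int.cast_zero]
      refine if_congr ?_ rfl rfl
      simp only [funext_iff, Subtype.forall, Function.comp_apply] at hy hz ⊢
      constructor
      · exact fun h => ⟨fun v _ => (h v).2.2.1, fun v _ => (h v).2.2.2.1, fun v _ => (h v).2.2.2.2⟩
      · rintro ⟨h2, h3, h4⟩ v
        refine ⟨(hy v).symm, (hz v).symm, ?_⟩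
        by_cases hv : unitType (x v) = 0
        · exact ⟨h2 v hv, h3 v hv, h4 v hv⟩
        · rw [(h0 _ hv).1, (h0 _ hv).2, (h0 (y v) (by rwa [hy])).1, (h0 (y v) (by rwa [hy])).2,
            (h0 (z v) (by rwa [hz])).1, (h0 (z v) (by rwa [hz])).2]
          simp
    · rw [if_neg (fun h => hz (funext fun v => (h v (Finset.mem_univ _)).2.1.symm)), if_neg hz]
      simp
  · rw [if_neg (fun h => hy (funext fun v => (h v (Finset.mem_univ _)).1.symm)), if_neg hy]
    simp

/-- The bound for the rank of the tensor power of the algebra of units. -/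
theorem hasRank_prod_unitMul {τ K : ℝ}
    (h : ∀ m : ℕ, 1 ≤ m → ∃ r : ℕ, (r : ℝ) ≤ K * (m : ℝ) ^ τ ∧ MatMulWith m r) (s : ℕ) :
    ∃ R : ℕ, (R : ℝ) ≤ 2 * K * (2 ^ τ + 2) ^ s ∧
      HasRank (fun x y z : Fin s → Fin 6 => ((∏ v, unitMul (x v) (y v) (z v) : ℤ) : ℚ)) R := by
  have hP : ∀ P : Fin s → Fin 3, ∃ r : ℕ,
      (r : ℝ) ≤ K * ∏ v, (if P v = 0 then (2 : ℝ) ^ τ else 1) ∧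
      MatMulWith (Fintype.card ({v // P v = 0} → Fin 2)) r := by
    intro P
    obtain ⟨r, hr, hr'⟩ := h (Fintype.card ({v // P v = 0} → Fin 2)) Fintype.card_pos
    refine ⟨r, hr.trans_eq ?_, hr'⟩
    rw [Finset.prod_ite, Finset.prod_const_one, mul_one, Finset.prod_const, Fintype.card_fun,
      Fintype.card_fin, Fintype.card_subtype]
    push_cast
    rw [← Real.rpow_natCast, ← Real.rpow_natCast, ← Real.rpow_mul two_pos.le,
      ← Real.rpow_mul two_pos.le, mul_comm τ]
  choose r hr hr' using hP
  refine ⟨∑ P, 2 * r P, ?_, ?_⟩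
  · push_cast
    calc ∑ P, 2 * (r P : ℝ) ≤ ∑ P : Fin s → Fin 3,
          2 * (K * ∏ v, (if P v = 0 then (2 : ℝ) ^ τ else 1)) := by
          gcongr with P
          exact hr P
      _ = 2 * K * ∑ P : Fin s → Fin 3, ∏ v, (if P v = 0 then (2 : ℝ) ^ τ else 1) := by
          rw [Finset.mul_sum]
          exact Finset.sum_congr rfl fun _ _ => by ring
      _ = 2 * K * (2 ^ τ + 2) ^ s := by
          -- The sum over all patterns is the expansion of `(2 ^ τ + 1 + 1) ^ s`.
          have := Finset.prod_univ_sum (fun _ : Fin s => (univ : Finset (Fin 3)))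
            (fun _ j => if j = 0 then (2 : ℝ) ^ τ else 1)
          rw [Fintype.piFinset_univ] at this
          rw [← this, Finset.prod_const, Fin.sum_univ_three, Finset.card_univ, Fintype.card_fin]
          simp only [if_true, Fin.isValue, one_ne_zero, if_false, Fin.reduceEq]
          ring
  · simp_rw [prod_unitMul]
    exact HasRank.sum fun P => ((HasRank.matMulTensor_fintype (hr' P)).comp
      (fun x : Fin s → Fin 6 => (fun v => unitRow (x v), fun v => unitCol (x v)))
      (fun x : Fin s → Fin 6 => (fun v => unitRow (x v), fun v => unitCol (x v)))
      (fun x : Fin s → Fin 6 => (fun v => unitRow (x v), fun v => unitCol (x v)))).diag _ _ _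

/-- On the support, the column of `x` is the row of `y`, so the parity of `x` is the sum of the
`unitZeta` of `x` and `y`. By bilinearity the inversions become a sum of functions of single words,
and such diagonal scalings do not increase the rank. -/
theorem prod_unitMul_mul_sgn {s : ℕ} (x y z : Fin s → Fin 6) :
    (∏ v, unitMul (x v) (y v) (z v)) *
      sgn (inversions (fun v => unitParity (x v)) (fun v => unitParity (y v))) =
    sgn (inversions (fun v => unitZeta (x v)) (fun v => unitParity (x v))) *
    sgn (inversions (fun v => unitZeta (y v)) (fun v => unitParity (y v))) *
    sgn (inversions (fun v => unitZeta (z v)) (fun v => unitParity (z v))) *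
    ∏ v, unitMul (x v) (y v) (z v) := by
  by_cases h : ∏ v, unitMul (x v) (y v) (z v) = 0
  · simp [h]
  rw [mul_comm]
  congr 1
  rw [← ne_eq, Finset.prod_ne_zero_iff] at h
  have h' := fun v => of_unitMul_ne_zero _ _ _ (h v (Finset.mem_univ v))
  simp only [fun v => (h' v).1, fun v => (h' v).2.1]
  rw [← sgn_add, ← sgn_add, inversions_add_right,
    show inversions (fun v => unitParity (x v)) (fun v => unitParity (y v)) =
      inversions (fun v => unitZeta (x v) + unitZeta (y v)) (fun v => unitParity (y v)) by
      simp only [fun v => (h' v).2.2], inversions_add_left]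
  congr 1
  -- The term of `x` occurs once by itself and once inside the term of `z`; modulo two both
  -- disappear.
  linear_combination - zmod_two_add_self
    (inversions (fun v => unitZeta (x v)) (fun v => unitParity (x v)))

/-- The change of basis mixes only units of the same parity, so the sign can be read off after
passing to units. -/
theorem prod_stateMul_mul_sgn {s : ℕ} (x y z : Fin s → Fin 6) :
    (∏ v, stateMul (x v) (y v) (z v)) *
      sgn (inversions (fun v => stateParity (x v)) (fun v => stateParity (y v))) =
    ∑ x' : Fin s → Fin 6, ∑ y' : Fin s → Fin 6, ∑ z' : Fin s → Fin 6,
      (∏ v, toUnit (x v) (x' v)) * (∏ v, toUnit (y v) (y' v)) * (∏ v, ofUnit (z v) (z' v)) *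
      ((∏ v, unitMul (x' v) (y' v) (z' v)) *
        sgn (inversions (fun v => unitParity (x' v)) (fun v => unitParity (y' v)))) := by
  simp only [stateMul, Finset.prod_univ_sum, Fintype.piFinset_univ, Finset.prod_mul_distrib,
    Finset.sum_mul]
  refine Finset.sum_congr rfl fun x' _ => Finset.sum_congr rfl fun y' _ =>
    Finset.sum_congr rfl fun z' _ => ?_
  by_cases hx : ∏ v, toUnit (x v) (x' v) = 0
  · simp [hx]
  by_cases hy : ∏ v, toUnit (y v) (y' v) = 0
  · simp [hy]
  rw [← ne_eq, Finset.prod_ne_zero_iff] at hx hy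
  simp only [fun v => parity_of_toUnit_ne_zero _ _ (hx v (Finset.mem_univ v)),
    fun v => parity_of_toUnit_ne_zero _ _ (hy v (Finset.mem_univ v))]
  ring

theorem hasRank_prod_stateMul {s R : ℕ}
    (h : HasRank (fun x y z : Fin s → Fin 6 => ((∏ v, unitMul (x v) (y v) (z v) : ℤ) : ℚ)) R) :
    HasRank (fun x y z : Fin s → Fin 6 => (((∏ v, stateMul (x v) (y v) (z v)) *
      sgn (inversions (fun v => stateParity (x v)) (fun v => stateParity (y v))) : ℤ) : ℚ)) R := by
  have h1 := (h.diag
    (fun x => (sgn (inversions (fun v => unitZeta (x v)) (fun v => unitParity (x v))) : ℚ))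
    (fun x => (sgn (inversions (fun v => unitZeta (x v)) (fun v => unitParity (x v))) : ℚ))
    (fun x => (sgn (inversions (fun v => unitZeta (x v)) (fun v => unitParity (x v))) : ℚ))).pullback
    (fun x x' : Fin s → Fin 6 => ((∏ v, toUnit (x v) (x' v) : ℤ) : ℚ))
    (fun x x' : Fin s → Fin 6 => ((∏ v, toUnit (x v) (x' v) : ℤ) : ℚ))
    (fun x x' : Fin s → Fin 6 => ((∏ v, ofUnit (x v) (x' v) : ℤ) : ℚ))
  convert h1 using 4 with x y z
  rw [prod_stateMul_mul_sgn]
  simp only [prod_unitMul_mul_sgn]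
  push_cast
  rfl

/-- Expanding the inversions of `B + C` gives the two wanted terms and two mixed ones. The mixed
term of `B` of `x` with `C` of `y` cancels against the expansion of the `z` term; what is left of
the mixed terms is the count of `C` of `x` against `B` of `y` in both orders, handled by
`inversions_add_swap`. -/
theorem sgn_join {s : ℕ} (x y z : Fin s → Fin 6)
    (hB : ∀ v, bitB (z v) = bitB (x v) + bitB (y v))
    (hC : ∀ v, bitC (z v) = bitC (x v) + bitC (y v)) :
    inversions (fun v => bitB (x v)) (fun v => bitB (y v)) +
      inversions (fun v => bitC (x v)) (fun v => bitC (y v)) =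
    inversions (fun v => bitB (x v)) (fun v => bitC (x v)) +
    inversions (fun v => bitB (y v)) (fun v => bitC (y v)) +
    inversions (fun v => bitB (z v)) (fun v => bitC (z v)) +
    (∑ v, bitC (x v)) * (∑ v, bitB (y v)) + ∑ v, bitC (x v) * bitB (y v) +
    inversions (fun v => stateParity (x v)) (fun v => stateParity (y v)) := by
  simp only [hB, hC, stateParity, inversions_add_left, inversions_add_right,
    ← inversions_add_swap]
  have h2 : (2 : ZMod 2) = 0 := rfl
  linear_combination (-inversions (fun v => bitB (x v)) (fun v => bitC (x v))
    - inversions (fun v => bitB (y v)) (fun v => bitC (y v))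
    - inversions (fun v => bitB (x v)) (fun v => bitC (y v))
    - inversions (fun v => bitB (y v)) (fun v => bitC (x v))
    - inversions (fun v => bitC (x v)) (fun v => bitB (y v))
    - ∑ v, bitC (x v) * bitB (y v)) * h2

/-- A condition on total degrees is enough: if they add up but the degrees at some vertex do not,
then at some vertex the degree of `z` is too large, and there the filtered product vanishes. -/
theorem joinTensor_eq {s : ℕ} (x y z : Fin s → Fin 6) :
    joinTensor x y z =
      if ∑ v, stateDeg (z v) = ∑ v, stateDeg (x v) + ∑ v, stateDeg (y v) then
        sgn (inversions (fun v => bitB (x v)) (fun v => bitC (x v))) *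
        sgn (inversions (fun v => bitB (y v)) (fun v => bitC (y v))) *
        sgn (inversions (fun v => bitB (z v)) (fun v => bitC (z v))) *
        sgn ((∑ v, bitC (x v)) * (∑ v, bitB (y v))) *
        ((∏ v, stateMul (x v) (y v) (z v)) *
          sgn (inversions (fun v => stateParity (x v)) (fun v => stateParity (y v))))
      else 0 := by
  have hT : (∏ v, stateJoin (x v) (y v) (z v)) ≠ 0 → ∀ v, stateJoin (x v) (y v) (z v) ≠ 0 :=
    fun h v => Finset.prod_ne_zero_iff.1 h v (Finset.mem_univ _)
  by_cases hd : ∀ v, stateDeg (z v) = stateDeg (x v) + stateDeg (y v)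
  · rw [if_pos (by rw [← Finset.sum_add_distrib]; exact Finset.sum_congr rfl fun v _ => hd v),
      Finset.prod_congr rfl fun v _ => stateMul_eq _ _ _ (hd v), Finset.prod_mul_distrib,
      ← sgn_sum, joinTensor]
    by_cases h0 : (∏ v, stateJoin (x v) (y v) (z v)) = 0
    · simp [h0]
    · have h1 := fun v => of_stateJoin_ne_zero _ _ _ (hT h0 v)
      rw [sgn_join x y z (fun v => (h1 v).2.2.1) (fun v => (h1 v).2.2.2)]
      simp only [sgn_add]
      ring
  · have h0 : (∏ v, stateJoin (x v) (y v) (z v)) = 0 := by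
      by_contra h0
      exact hd fun v => (of_stateJoin_ne_zero _ _ _ (hT h0 v)).2.1
    rw [joinTensor, h0, zero_mul]
    split_ifs with hs
    · obtain ⟨v, hv⟩ : ∃ v, stateDeg (x v) + stateDeg (y v) < stateDeg (z v) := by
        by_contra hcon
        push Not at hcon
        rw [← Finset.sum_add_distrib] at hs
        exact hd fun v => (Finset.sum_eq_sum_iff_of_le fun v _ => hcon v).1 hs v (Finset.mem_univ v)
      rw [Finset.prod_eq_zero (Finset.mem_univ v) (stateMul_eq_zero _ _ _ hv)]
      simp
    · rfl

/-- The degree condition and the product of parities become products of functions of single words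
once the degrees of `x` and `y` and the parity of `C` of `x` are fixed, which gives `(2 * s + 1) ^ 2
* 2` cases. -/
theorem hasRank_joinTensor {s R : ℕ}
    (h : HasRank (fun x y z : Fin s → Fin 6 => ((∏ v, unitMul (x v) (y v) (z v) : ℤ) : ℚ)) R) :
    HasRank (fun x y z : Fin s → Fin 6 => (joinTensor x y z : ℚ))
      (2 * (2 * s + 1) ^ 2 * R) := by
  have hdeg : ∀ x : Fin s → Fin 6, ∑ v, stateDeg (x v) < 2 * s + 1 := by
    intro x
    have : ∑ v, stateDeg (x v) ≤ ∑ v : Fin s, 2 :=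
      Finset.sum_le_sum fun v _ => by generalize x v = d; revert d; decide
    simp at this
    omega
  have h1 := HasRank.sum fun i : Fin (2 * s + 1) × Fin (2 * s + 1) × ZMod 2 =>
    (hasRank_prod_stateMul h).diag
    (fun x => (sgn (inversions (fun v => bitB (x v)) (fun v => bitC (x v))) : ℚ) *
      if ∑ v, stateDeg (x v) = i.1 ∧ ∑ v, bitC (x v) = i.2.2 then 1 else 0)
    (fun y => (sgn (inversions (fun v => bitB (y v)) (fun v => bitC (y v))) : ℚ) *
      if ∑ v, stateDeg (y v) = i.2.1 then (sgn (i.2.2 * ∑ v, bitB (y v)) : ℚ) else 0)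
    (fun z => (sgn (inversions (fun v => bitB (z v)) (fun v => bitC (z v))) : ℚ) *
      if ∑ v, stateDeg (z v) = i.1 + i.2.1 then 1 else 0)
  convert h1 using 1
  · funext x y z
    rw [joinTensor_eq, Finset.sum_eq_single (⟨_, hdeg x⟩, ⟨_, hdeg y⟩, ∑ v, bitC (x v))]
    · simp only [if_true, and_self]
      split_ifs
      · push_cast
        ring
      · simp
    · rintro ⟨i, j, q⟩ - hne
      by_cases hi : ∑ v, stateDeg (x v) = i
      · by_cases hj : ∑ v, stateDeg (y v) = j
        · by_cases hq : ∑ v, bitC (x v) = q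
          · exact absurd (by simp [hi, hj, hq]) hne
          · simp [hq]
        · simp [hj]
      · simp [hi]
    · simp
  · rw [Finset.sum_const, Finset.card_univ, Fintype.card_prod, Fintype.card_prod,
      Fintype.card_fin, ZMod.card, smul_eq_mul]
    ring

/-! ### Words over the six states, coded by numbers in base six -/

/-- The word of length `n` given by the base-six digits of `i`. -/
def word (n i : ℕ) : Fin n → Fin 6 := fun v => ⟨i / 6 ^ (v : ℕ) % 6, Nat.mod_lt _ (by norm_num)⟩

def wordTensor (n i j k : ℕ) : ℤ := joinTensor (word n i) (word n j) (word n k)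

/-- The parities of the second and of the third set of a word. -/
def wordClass (n i : ℕ) : ZMod 2 × ZMod 2 :=
  (∑ v, bitB (word n i v), ∑ v, bitC (word n i v))

def classDot (p q : ZMod 2 × ZMod 2) : ZMod 2 := p.1 * q.1 + p.2 * q.2

theorem word_castAdd {n s i : ℕ} (a : ℕ) (v : Fin n) :
    word (n + s) (i + 6 ^ n * a) (Fin.castAdd s v) = word n i v := by
  have hv : 6 ^ n = 6 ^ (v : ℕ) * (6 * 6 ^ (n - v - 1)) := by
    rw [← pow_succ', ← pow_add]
    congr 1
    omega
  simp only [word, Fin.ext_iff, Fin.val_castAdd]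
  rw [hv, mul_assoc, Nat.add_mul_div_left _ _ (by positivity), mul_assoc, Nat.add_mul_mod_self_left]

theorem word_natAdd {n s i : ℕ} (a : ℕ) (hi : i < 6 ^ n) (v : Fin s) :
    word (n + s) (i + 6 ^ n * a) (Fin.natAdd n v) = word s a v := by
  simp only [word, Fin.ext_iff, Fin.val_natAdd]
  rw [pow_add, ← Nat.div_div_eq_div_mul, Nat.add_mul_div_left _ _ (by positivity),
    Nat.div_eq_of_lt hi, zero_add]

/-- Across the two blocks, a pair is an inversion exactly when its first entry lies in the upper
block, so the cross term factors into two sums. -/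
theorem inversions_fin_add {n s : ℕ} (φ ψ : Fin (n + s) → ZMod 2) :
    inversions φ ψ = inversions (fun v => φ (Fin.castAdd s v)) (fun v => ψ (Fin.castAdd s v)) +
      inversions (fun v => φ (Fin.natAdd n v)) (fun v => ψ (Fin.natAdd n v)) +
      (∑ v, ψ (Fin.castAdd s v)) * ∑ v, φ (Fin.natAdd n v) := by
  have h1 : ∀ (v : Fin n) (w : Fin s), ¬ Fin.natAdd n w < Fin.castAdd s v := fun v w => by
    simp [Fin.lt_def]; omega
  have h2 : ∀ (v : Fin n) (w : Fin s), Fin.castAdd s v < Fin.natAdd n w := fun v w => by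
    simp [Fin.lt_def]; omega
  have h3 : ∀ (v w : Fin n), Fin.castAdd s v < Fin.castAdd s w ↔ v < w := fun v w => Iff.rfl
  have h4 : ∀ (v w : Fin s), Fin.natAdd n v < Fin.natAdd n w ↔ v < w := fun v w => by
    simp only [Fin.lt_def, Fin.val_natAdd, add_lt_add_iff_left]
  simp only [inversions, Fin.sum_univ_add, h1, h2, h3, h4, if_true, if_false, zero_mul, one_mul,
    Finset.sum_const_zero, Finset.sum_add_distrib]
  rw [mul_comm, Finset.sum_mul_sum]
  ring

theorem wordClass_add {n s i : ℕ} (a : ℕ) (hi : i < 6 ^ n) :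
    wordClass (n + s) (i + 6 ^ n * a) = wordClass n i + wordClass s a := by
  simp only [wordClass, Fin.sum_univ_add, word_castAdd a, word_natAdd a hi, Prod.mk_add_mk]

/-- Blocks interact only through the cross inversions, and these see only the parities of the lower
part of the second word and of the upper part of the first. -/
theorem wordTensor_add {n s i j k : ℕ} (a b c : ℕ) (hi : i < 6 ^ n) (hj : j < 6 ^ n)
    (hk : k < 6 ^ n) :
    wordTensor (n + s) (i + 6 ^ n * a) (j + 6 ^ n * b) (k + 6 ^ n * c) =
      wordTensor n i j k * wordTensor s a b c * sgn (classDot (wordClass n j) (wordClass s a)) := by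
  simp only [wordTensor, joinTensor, classDot, wordClass, inversions_fin_add, Fin.prod_univ_add,
    word_castAdd, word_natAdd _ hi, word_natAdd _ hj, word_natAdd _ hk, sgn_add]
  ring

/-- The digit zero is the empty state, so words may be padded by leading zeros up to a whole number
of blocks. -/
theorem wordTensor_add_zero {n s i j k : ℕ} (hi : i < 6 ^ n) (hj : j < 6 ^ n)
    (hk : k < 6 ^ n) : wordTensor (n + s) i j k = wordTensor n i j k := by
  have h0 : ∀ v, word s 0 v = 0 := fun v => by simp [word]
  have := wordTensor_add (s := s) 0 0 0 hi hj hk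
  simp only [mul_zero, add_zero] at this
  have hc : wordClass s 0 = 0 := by simp [wordClass, h0, bitB, bitC, natB, natC]
  rw [this, hc]
  simp [wordTensor, joinTensor, h0, bitB, bitC, natB, natC, stateJoin, natA, inversions, classDot,
    sgn_zero]

/-! ### The four classes as numbers -/

def classOfNat (e : ℕ) : ZMod 2 × ZMod 2 := ((e : ZMod 2), ((e / 2 : ℕ) : ZMod 2))

theorem sum_range_four_classOfNat {M : Type*} [AddCommMonoid M] (q : ZMod 2 × ZMod 2)
    (F : ZMod 2 × ZMod 2 → M) :
    ∑ e ∈ range 4, (if classOfNat e = q then F (classOfNat e) else 0) = F q := by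
  have h0 : classOfNat 0 = (0, 0) := rfl
  have h1 : classOfNat 1 = (1, 0) := rfl
  have h2 : classOfNat 2 = (0, 1) := rfl
  have h3 : classOfNat 3 = (1, 1) := rfl
  simp only [Finset.sum_range_succ, Finset.sum_range_zero, h0, h1, h2, h3]
  have hq : q = (0, 0) ∨ q = (1, 0) ∨ q = (0, 1) ∨ q = (1, 1) := by revert q; decide
  rcases hq with rfl | rfl | rfl | rfl <;> simp

theorem sum_range_mul {M : Type*} [AddCommMonoid M] (a b : ℕ) (F : ℕ → M) :
    ∑ i ∈ range (a * b), F i = ∑ q ∈ range b, ∑ r ∈ range a, F (r + a * q) := by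
  induction b with
  | zero => simp
  | succ b ih =>
    rw [Nat.mul_succ, Finset.sum_range_add, ih, Finset.sum_range_succ]
    simp only [add_comm]

/-! ### The decomposition of the tensor of a block -/

theorem exists_common_denominator (u : ℕ → ℕ → ℚ) (R d : ℕ) :
    ∃ D : ℕ, 0 < D ∧ ∃ z : ℕ → ℕ → ℤ, ∀ ρ < R, ∀ a < d, (z ρ a : ℚ) = D * u ρ a := by
  refine ⟨∏ ρ ∈ range R, ∏ a ∈ range d, (u ρ a).den, ?_, ?_⟩
  · exact Finset.prod_pos fun ρ _ => Finset.prod_pos fun a _ => (u ρ a).den_pos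
  · have : ∀ ρ a, ∃ z : ℤ, ρ < R → a < d →
        (z : ℚ) = (∏ ρ ∈ range R, ∏ a ∈ range d, (u ρ a).den : ℕ) * u ρ a := by
      intro ρ a
      by_cases h : ρ < R ∧ a < d
      · obtain ⟨c, hc⟩ : (u ρ a).den ∣ ∏ ρ ∈ range R, ∏ a ∈ range d, (u ρ a).den :=
          (Finset.dvd_prod_of_mem (fun a => (u ρ a).den) (Finset.mem_range.2 h.2)).trans
            (Finset.dvd_prod_of_mem (fun ρ => ∏ a ∈ range d, (u ρ a).den)
              (Finset.mem_range.2 h.1))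
        refine ⟨c * (u ρ a).num, fun _ _ => ?_⟩
        rw [hc]
        push_cast
        have := Rat.den_mul_eq_num (u ρ a)
        linear_combination (c : ℚ) * (-this)
      · exact ⟨0, fun h1 h2 => absurd ⟨h1, h2⟩ h⟩
    choose z hz using this
    exact ⟨z, fun ρ hρ a ha => hz ρ a hρ ha⟩

/-- A decomposition of the tensor of a block of `s` vertices, in which every term sees only one
class of second arguments. -/
structure BlockDecomposition (s R D : ℕ) where
  U : ℕ → ℕ → ℤ
  V : ℕ → ℕ → ℤ
  W : ℕ → ℕ → ℤ
  cls : ℕ → ZMod 2 × ZMod 2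
  cls_eq : ∀ ρ b, V ρ b ≠ 0 → cls ρ = wordClass s b
  sum_eq : ∀ a < 6 ^ s, ∀ b < 6 ^ s, ∀ c < 6 ^ s,
    ∑ ρ ∈ range R, U ρ a * V ρ b * W c ρ = D * wordTensor s a b c

/-- Each term is used four times, once per class: the index is `r + R * q`, and copy `q` retains
only second arguments of class `q`. The three common denominators multiply to `D`. -/
theorem HasRank.exists_blockDecomposition {s R : ℕ}
    (h : HasRank (fun x y z : Fin s → Fin 6 => (joinTensor x y z : ℚ)) R) :
    ∃ D : ℕ, 0 < D ∧ Nonempty (BlockDecomposition s (R * 4) D) := by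
  obtain ⟨u, v, w, h⟩ := h.comp (word s) (word s) (word s)
  obtain ⟨D₁, hD₁, U, hU⟩ := exists_common_denominator u R (6 ^ s)
  obtain ⟨D₂, hD₂, V, hV⟩ := exists_common_denominator v R (6 ^ s)
  obtain ⟨D₃, hD₃, W, hW⟩ := exists_common_denominator w R (6 ^ s)
  refine ⟨D₁ * D₂ * D₃, by positivity, ⟨fun ρ a => U (ρ % R) a,
    fun ρ b => if classOfNat (ρ / R) = wordClass s b then V (ρ % R) b else 0,
    fun c ρ => W (ρ % R) c, fun ρ => classOfNat (ρ / R), fun ρ b hb => ?_,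
    fun a ha b hb c hc => ?_⟩⟩
  · by_contra hne
    simp [hne] at hb
  · rw [sum_range_mul]
    have h1 : ∀ q ∈ range 4, ∑ r ∈ range R, U ((r + R * q) % R) a *
        (if classOfNat ((r + R * q) / R) = wordClass s b then V ((r + R * q) % R) b else 0) *
        W ((r + R * q) % R) c = if classOfNat q = wordClass s b then
          ∑ r ∈ range R, U r a * V r b * W r c else 0 := by
      intro q _
      rw [show (if classOfNat q = wordClass s b then ∑ r ∈ range R, U r a * V r b * W r c else 0) =
        ∑ r ∈ range R, if classOfNat q = wordClass s b then U r a * V r b * W r c else 0 by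
          split_ifs <;> simp]
      refine Finset.sum_congr rfl fun r hr => ?_
      have hr := Finset.mem_range.1 hr
      rw [Nat.add_mul_mod_self_left, Nat.mod_eq_of_lt hr, Nat.add_mul_div_left _ _ (by omega),
        Nat.div_eq_of_lt hr, zero_add]
      split_ifs <;> simp
    rw [Finset.sum_congr rfl h1,
      sum_range_four_classOfNat _ (fun _ => ∑ r ∈ range R, U r a * V r b * W r c)]
    have h2 : ((∑ r ∈ range R, U r a * V r b * W r c : ℤ) : ℚ) =
        ((D₁ * D₂ * D₃ : ℕ) * wordTensor s a b c : ℤ) := by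
      push_cast
      have h' := h a b c
      simp only at h'
      rw [wordTensor, h', Finset.mul_sum]
      refine Finset.sum_congr rfl fun r hr => ?_
      have hr := Finset.mem_range.1 hr
      rw [hU r hr a ha, hV r hr b hb, hW r hr c hc]
      ring
    exact_mod_cast h2

/-- Since `τ` lies strictly below the exponent allowed, the ratio of the two bases beats every
constant and polynomial factor once `s` is large. The bound `6 ^ s ≤ R` later controls arrays whose
indices have digits of both kinds. -/
theorem exists_blockDecomposition {δ : ℝ} (hδ : 0 < δ) :
    ∃ s R D : ℕ, 0 < s ∧ 0 < D ∧ 6 ^ s ≤ R ∧ (R : ℝ) ≤ (2 ^ (matMulExponent + δ) + 2) ^ s ∧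
      Nonempty (BlockDecomposition s R D) := by
  obtain ⟨τ, K, hτ, hK⟩ := exists_matMul_lt hδ
  have hY : (2 : ℝ) ^ τ + 2 < 2 ^ (matMulExponent + δ) + 2 := by
    have := Real.rpow_lt_rpow_of_exponent_lt one_lt_two hτ
    linarith
  have hX : (6 : ℝ) < 2 ^ (matMulExponent + δ) + 2 := by
    have h := Real.rpow_lt_rpow_of_exponent_lt one_lt_two
      (show (2 : ℝ) < matMulExponent + δ by linarith [two_le_matMulExponent])
    norm_num at h
    linarith
  set X : ℝ := 2 ^ (matMulExponent + δ) + 2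
  set Y : ℝ := 2 ^ τ + 2
  have hY0 : 0 < Y := by positivity
  have hX0 : 0 < X := by linarith
  have t1 := tendsto_pow_const_mul_const_pow_of_abs_lt_one 2
    (show |Y / X| < 1 by rw [abs_of_pos (by positivity), div_lt_one hX0]; exact hY)
  have t2 := tendsto_pow_atTop_nhds_zero_of_abs_lt_one
    (show |6 / X| < 1 by rw [abs_of_pos (by positivity), div_lt_one hX0]; exact hX)
  -- The constant is `144 = 2 * 9 * 2 * 4`, from `2 * (2 * s + 1) ^ 2 ≤ 2 * 9 * s ^ 2`, the factor
  -- `2 * K` of the rank bound and the four classes; the `1 / 4` also pays for the classes.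
  obtain ⟨s, ⟨h1, h2⟩, hs⟩ := (((t1.eventually_lt_const
    (show (0 : ℝ) < 1 / (144 * (|K| + 1)) by positivity)).and (t2.eventually_lt_const
    (show (0 : ℝ) < 1 / 4 by norm_num))).and (Filter.eventually_ge_atTop 1)).exists
  obtain ⟨R, hR, hR'⟩ := hasRank_prod_unitMul hK s
  have hr := hasRank_joinTensor hR'
  obtain ⟨D, hD, hB⟩ :=
    (hr.mono (le_max_left _ (6 ^ s))).exists_blockDecomposition
  refine ⟨s, _, D, hs, hD, (le_max_right _ _).trans (Nat.le_mul_of_pos_right _ (by norm_num)),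
    ?_, hB⟩
  push_cast
  rw [max_mul_of_nonneg _ _ (by norm_num)]
  apply max_le
  · rw [div_pow, ← mul_div_assoc, div_lt_div_iff₀ (by positivity) (by positivity)] at h1
    have hs' : (1 : ℝ) ≤ s := by exact_mod_cast hs
    have h3 : (2 * (s : ℝ) + 1) ^ 2 ≤ 9 * s ^ 2 := by nlinarith
    calc 2 * (2 * (s : ℝ) + 1) ^ 2 * R * 4 ≤ 2 * (9 * s ^ 2) * (2 * (|K| + 1) * Y ^ s) * 4 := by
          gcongr
          refine hR.trans ?_
          gcongr
          linarith [le_abs_self K]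
      _ ≤ X ^ s := by linarith
  · rw [div_pow, div_lt_div_iff₀ (by positivity) (by norm_num)] at h2
    linarith

/-! ### The join convolution in terms of words -/

theorem mem_rowA {n i : ℕ} {v : Fin n} : v ∈ rowA n i ↔ natA (word n i v) = 1 := by
  have h : ∀ d : Fin 6, (d : ℕ) ∈ ({1, 2, 5} : Finset ℕ) ↔ natA d = 1 := by decide
  simp only [rowA, Finset.mem_filter, Finset.mem_univ, true_and]
  exact h (word n i v)

theorem mem_rowB {n i : ℕ} {v : Fin n} : v ∈ rowB n i ↔ natB (word n i v) = 1 := by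
  have h : ∀ d : Fin 6, (d : ℕ) ∈ ({3, 4, 5} : Finset ℕ) ↔ natB d = 1 := by decide
  simp only [rowB, Finset.mem_filter, Finset.mem_univ, true_and]
  exact h (word n i v)

theorem mem_rowC {n i : ℕ} {v : Fin n} : v ∈ rowC n i ↔ natC (word n i v) = 1 := by
  have h : ∀ d : Fin 6, (d : ℕ) ∈ ({2, 4, 5} : Finset ℕ) ↔ natC d = 1 := by decide
  simp only [rowC, Finset.mem_filter, Finset.mem_univ, true_and]
  exact h (word n i v)

theorem word_injOn (n : ℕ) : Set.InjOn (word n) (range (6 ^ n)) := by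
  intro i hi j hj h
  have hi := Finset.mem_range.1 hi
  have hj := Finset.mem_range.1 hj
  have : (finFunctionFinEquiv.symm ⟨i, hi⟩ : Fin n → Fin 6) = finFunctionFinEquiv.symm ⟨j, hj⟩ := h
  simpa using finFunctionFinEquiv.symm.injective this

theorem row_injOn (n : ℕ) :
    Set.InjOn (fun i => (rowA n i, rowB n i, rowC n i)) (range (6 ^ n)) := by
  intro i hi j hj h
  refine word_injOn n hi hj (funext fun v => ?_)
  simp only [Prod.mk.injEq] at h
  have hA : natA (word n i v) = 1 ↔ natA (word n j v) = 1 := by rw [← mem_rowA, h.1, mem_rowA]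
  have hB : natB (word n i v) = 1 ↔ natB (word n j v) = 1 := by rw [← mem_rowB, h.2.1, mem_rowB]
  have hC : natC (word n i v) = 1 ↔ natC (word n j v) = 1 := by rw [← mem_rowC, h.2.2, mem_rowC]
  revert hA hB hC
  generalize word n i v = a
  generalize word n j v = b
  revert a b
  decide

theorem sum_triples_eq_sum_rows {n : ℕ} {M : Type*} [AddCommMonoid M]
    (G : Finset (Fin n) → Finset (Fin n) → Finset (Fin n) → M)
    (hG : ∀ A B C, G A B C ≠ 0 → AllowedTriple A B C) :
    ∑ t : Finset (Fin n) × Finset (Fin n) × Finset (Fin n), G t.1 t.2.1 t.2.2 =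
      ∑ i ∈ range (6 ^ n), G (rowA n i) (rowB n i) (rowC n i) := by
  symm
  refine Finset.sum_of_injOn (fun i => (rowA n i, rowB n i, rowC n i)) (row_injOn n)
    (fun _ _ => Finset.mem_coe.2 (Finset.mem_univ _)) ?_ (fun _ _ => rfl)
  rintro ⟨A, B, C⟩ - h
  by_contra h0
  obtain ⟨i, hi, rfl, rfl, rfl⟩ := (allowedTriple_iff_row n A B C).1 (hG _ _ _ h0)
  exact h ⟨i, by simpa using hi, rfl⟩

theorem orderSign_eq_sgn {n : ℕ} (X Y : Finset (Fin n)) (φ ψ : Fin n → ZMod 2)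
    (hφ : ∀ v, φ v = if v ∈ X then 1 else 0) (hψ : ∀ v, ψ v = if v ∈ Y then 1 else 0) :
    orderSign X Y = sgn (inversions φ ψ) := by
  rw [orderSign, ← sgn_natCast, Finset.card_filter, inversions, Finset.sum_product]
  congr 1
  push_cast
  rw [← Finset.sum_filter_add_sum_filter_not univ (· ∈ X)]
  have h2 : ∑ v with v ∉ X, ∑ w, (if w < v then 1 else 0) * (φ v * ψ w) = 0 :=
    Finset.sum_eq_zero fun v hv => Finset.sum_eq_zero fun w _ => by
      simp [hφ, (Finset.mem_filter.1 hv).2]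
  rw [h2, add_zero]
  simp only [Finset.filter_mem_eq_inter, Finset.univ_inter]
  refine Finset.sum_congr rfl fun v hv => ?_
  simp [hφ, hψ, hv]

theorem union_eq_inter_eq_empty_iff {U : Type*} [DecidableEq U] {X Y Z : Finset U}
    {a b c : U → ℕ} (ha : ∀ v, v ∈ X ↔ a v = 1) (hb : ∀ v, v ∈ Y ↔ b v = 1)
    (hc : ∀ v, v ∈ Z ↔ c v = 1) (h : ∀ v, a v ≤ 1 ∧ b v ≤ 1 ∧ c v ≤ 1) :
    (X ∪ Y = Z ∧ X ∩ Y = ∅) ↔ ∀ v, a v + b v = c v := by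
  simp only [Finset.ext_iff, ← forall_and, Finset.mem_union, Finset.mem_inter, ha, hb, hc,
    Finset.notMem_empty, iff_false]
  refine forall_congr' fun v => ?_
  have := h v
  omega

/-- Indicators take values in `{0, 1}`, so they add up at every vertex precisely for a disjoint
union. -/
theorem wordTensor_eq (n i j k : ℕ) :
    wordTensor n i j k =
      if (rowA n i ∪ rowA n j = rowA n k ∧ rowA n i ∩ rowA n j = ∅) ∧
        (rowB n i ∪ rowB n j = rowB n k ∧ rowB n i ∩ rowB n j = ∅) ∧
        (rowC n i ∪ rowC n j = rowC n k ∧ rowC n i ∩ rowC n j = ∅) then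
        orderSign (rowB n i) (rowB n j) * orderSign (rowC n i) (rowC n j) else 0 := by
  have hB : ∀ i v, bitB (word n i v) = if v ∈ rowB n i then 1 else 0 := by
    intro i v
    simp only [mem_rowB]
    generalize word n i v = d
    revert d; decide
  have hC : ∀ i v, bitC (word n i v) = if v ∈ rowC n i then 1 else 0 := by
    intro i v
    simp only [mem_rowC]
    generalize word n i v = d
    revert d; decide
  rw [orderSign_eq_sgn _ _ _ _ (hB i) (hB j), orderSign_eq_sgn _ _ _ _ (hC i) (hC j), ← sgn_add,
    wordTensor, joinTensor]
  have hle : ∀ d : Fin 6, natA d ≤ 1 ∧ natB d ≤ 1 ∧ natC d ≤ 1 := by decide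
  rw [if_congr ((and_congr (union_eq_inter_eq_empty_iff (fun _ => mem_rowA) (fun _ => mem_rowA)
    (fun _ => mem_rowA) fun _ => ⟨(hle _).1, (hle _).1, (hle _).1⟩) (and_congr
    (union_eq_inter_eq_empty_iff (fun _ => mem_rowB) (fun _ => mem_rowB)
    (fun _ => mem_rowB) fun _ => ⟨(hle _).2.1, (hle _).2.1, (hle _).2.1⟩)
    (union_eq_inter_eq_empty_iff (fun _ => mem_rowC) (fun _ => mem_rowC)
    (fun _ => mem_rowC) fun _ => ⟨(hle _).2.2, (hle _).2.2, (hle _).2.2⟩)))) rfl rfl]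
  split_ifs with h
  · rw [Finset.prod_eq_one, one_mul]
    exact fun v _ => if_pos ⟨h.1 v, h.2.1 v, h.2.2 v⟩
  · rw [← forall_and, ← forall_and, not_forall] at h
    obtain ⟨v, hv⟩ := h
    rw [Finset.prod_eq_zero (Finset.mem_univ v), zero_mul]
    exact if_neg hv

/-- Regroups three splittings into two triples, one for each factor of the convolution. -/
theorem sum_filter_triples {F : Type*} [Fintype F] (P Q R : F × F → Prop) [DecidablePred P]
    [DecidablePred Q] [DecidablePred R] (G : F → F → F → F → F → F → ℤ) :
    ∑ a with P a, ∑ b with Q b, ∑ c with R c, G a.1 b.1 c.1 a.2 b.2 c.2 =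
      ∑ p : F × F × F, ∑ q : F × F × F,
        if P (p.1, q.1) ∧ Q (p.2.1, q.2.1) ∧ R (p.2.2, q.2.2) then
          G p.1 p.2.1 p.2.2 q.1 q.2.1 q.2.2 else 0 := by
  let e : (F × F) × (F × F) × (F × F) ≃ (F × F × F) × (F × F × F) :=
    ⟨fun t => ((t.1.1, t.2.1.1, t.2.2.1), (t.1.2, t.2.1.2, t.2.2.2)),
      fun t => ((t.1.1, t.2.1), (t.1.2.1, t.2.2.1), (t.1.2.2, t.2.2.2)), fun _ => rfl, fun _ => rfl⟩
  have h2 := Fintype.sum_prod_type (fun t : (F × F × F) × (F × F × F) =>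
    if P (t.1.1, t.2.1) ∧ Q (t.1.2.1, t.2.2.1) ∧ R (t.1.2.2, t.2.2.2) then
          G t.1.1 t.1.2.1 t.1.2.2 t.2.1 t.2.2.1 t.2.2.2 else 0)
  rw [← h2, ← e.sum_comp, Fintype.sum_prod_type, Finset.sum_filter]
  refine Finset.sum_congr rfl fun a _ => ?_
  rw [Fintype.sum_prod_type]
  simp only [Finset.sum_filter, e, Equiv.coe_fn_mk]
  split_ifs with ha
  · refine Finset.sum_congr rfl fun b _ => ?_
    split_ifs with hb
    · exact Finset.sum_congr rfl fun c _ => by simp only [ha, hb, true_and]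
    · simp [hb]
  · simp [ha]

theorem joinConv_row {n : ℕ} {f g : Finset (Fin n) → Finset (Fin n) → Finset (Fin n) → ℤ}
    (hf : SupportedOnAllowed f) (hg : SupportedOnAllowed g) (k : ℕ) :
    joinConv f g (rowA n k) (rowB n k) (rowC n k) =
      ∑ i ∈ range (6 ^ n), ∑ j ∈ range (6 ^ n), f (rowA n i) (rowB n i) (rowC n i) *
        g (rowA n j) (rowB n j) (rowC n j) * wordTensor n i j k := by
  rw [joinConv]
  simp only [splits]
  rw [sum_filter_triples (fun a => a.1 ∪ a.2 = rowA n k ∧ a.1 ∩ a.2 = ∅)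
    (fun a => a.1 ∪ a.2 = rowB n k ∧ a.1 ∩ a.2 = ∅)
    (fun a => a.1 ∪ a.2 = rowC n k ∧ a.1 ∩ a.2 = ∅)
    (fun A B C A' B' C' => f A B C * g A' B' C' * orderSign B B' * orderSign C C')]
  rw [sum_triples_eq_sum_rows (fun A B C => ∑ q : Finset (Fin n) × Finset (Fin n) × Finset (Fin n),
      if (A ∪ q.1 = rowA n k ∧ A ∩ q.1 = ∅) ∧ (B ∪ q.2.1 = rowB n k ∧ B ∩ q.2.1 = ∅) ∧
        (C ∪ q.2.2 = rowC n k ∧ C ∩ q.2.2 = ∅) then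
      f A B C * g q.1 q.2.1 q.2.2 * orderSign B q.2.1 * orderSign C q.2.2 else 0)]
  · refine Finset.sum_congr rfl fun i _ => ?_
    rw [sum_triples_eq_sum_rows (fun A B C =>
      if (rowA n i ∪ A = rowA n k ∧ rowA n i ∩ A = ∅) ∧ (rowB n i ∪ B = rowB n k ∧
        rowB n i ∩ B = ∅) ∧ (rowC n i ∪ C = rowC n k ∧ rowC n i ∩ C = ∅) then
      f (rowA n i) (rowB n i) (rowC n i) * g A B C * orderSign (rowB n i) B *
        orderSign (rowC n i) C else 0)]
    · refine Finset.sum_congr rfl fun j _ => ?_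
      rw [wordTensor_eq, mul_ite, mul_zero, mul_assoc _ (orderSign _ _)]
    · exact fun A B C h => hg A B C fun h0 => h (by simp [h0])
  · exact fun A B C h => hf A B C fun h0 => h (by simp [h0])

/-! ### Iterated linear transforms of the digits of the index

An index consists of a bond `e < E` and of digits; a step replaces the lowest digit (in base
`din`) by a highest digit (in base `dout`) and updates the bond, by means of the matrix `K`. -/

/-- The untouched digits form a number below `m`. It stands above the old lowest digit in the source
and below the new highest digit in the result, so repeated steps rotate through all digits. -/
def yatesStep (E din : ℕ) (K : ℕ → ℕ → ℕ → ℤ) (m : ℕ) (X : ℕ → ℤ) : ℕ → ℤ := fun o =>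
  ∑ c ∈ range (E * din), K (o % E) (o / E / m) c * X (c + E * din * (o / E % m))

/-- There are `q + 1` digits in all. At step `t`, besides the digit being replaced, `t` new and `q -
t` old digits are present, whence the modulus. -/
def yatesIter (E din dout : ℕ) (K : ℕ → ℕ → ℕ → ℤ) (q : ℕ) (X : ℕ → ℤ) : ℕ → ℕ → ℤ
  | 0 => X
  | t + 1 => yatesStep E din K (dout ^ t * din ^ (q - t)) (yatesIter E din dout K q X t)

/-- The matrix of the transform of `t` digits. -/
def yatesKernel (E din dout : ℕ) (K : ℕ → ℕ → ℕ → ℤ) : ℕ → ℕ → ℕ → ℕ → ℕ → ℤ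
  | 0, e', _, e, _ => if e' = e then 1 else 0
  | t + 1, e', ρ, e, i => ∑ e'' ∈ range E, K e' (ρ / dout ^ t) (e'' + E * (i / din ^ t)) *
      yatesKernel E din dout K t e'' (ρ % dout ^ t) e (i % din ^ t)

/-- The invariant of the rotation: after `t` steps the unprocessed digits `r` are the low part of
the index and the new digits `ρ` the high part. -/
theorem yatesIter_eq (E din dout : ℕ) (K : ℕ → ℕ → ℕ → ℤ) (q : ℕ) (X : ℕ → ℤ) (t : ℕ)
    (ht : t ≤ q + 1) (e' r ρ : ℕ) (he' : e' < E) (hr : r < din ^ (q + 1 - t)) (hρ : ρ < dout ^ t) :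
    yatesIter E din dout K q X t (e' + E * (r + din ^ (q + 1 - t) * ρ)) =
      ∑ e ∈ range E, ∑ i ∈ range (din ^ t),
        yatesKernel E din dout K t e' ρ e i * X (e + E * (i + din ^ t * r)) := by
  induction t generalizing e' r ρ with
  | zero =>
    have : ρ = 0 := by simpa using hρ
    subst this
    simp [yatesIter, yatesKernel, he']
  | succ t ih =>
    have hq : q + 1 - (t + 1) = q - t := by omega
    have hq' : q + 1 - t = q - t + 1 := by omega
    rw [hq] at hr ⊢
    have hD : 0 < dout ^ t := by
      by_contra h
      have : dout ^ t = 0 := by omega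
      rw [pow_succ, this] at hρ
      omega
    have hd : 0 < din ^ (q - t) := by omega
    have hρ' : ρ % dout ^ t < dout ^ t := Nat.mod_lt _ hD
    obtain ⟨ρ', ρt, h1, h2, hρ1⟩ : ∃ ρ' ρt, ρ % dout ^ t = ρ' ∧ ρ / dout ^ t = ρt ∧
        ρ = ρ' + dout ^ t * ρt := ⟨_, _, rfl, rfl, (Nat.mod_add_div _ _).symm⟩
    rw [h1] at hρ'
    have hb : r + din ^ (q - t) * ρ' < dout ^ t * din ^ (q - t) := by
      calc r + din ^ (q - t) * ρ' < din ^ (q - t) * (ρ' + 1) := by rw [Nat.mul_succ]; omega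
        _ ≤ din ^ (q - t) * dout ^ t := Nat.mul_le_mul_left _ hρ'
        _ = _ := mul_comm _ _
    have hm : r + din ^ (q - t) * ρ =
        r + din ^ (q - t) * ρ' + dout ^ t * din ^ (q - t) * ρt := by rw [hρ1]; ring
    have i1 : (e' + E * (r + din ^ (q - t) * ρ)) % E = e' := by
      rw [Nat.add_mul_mod_self_left, Nat.mod_eq_of_lt he']
    have i2 : (e' + E * (r + din ^ (q - t) * ρ)) / E = r + din ^ (q - t) * ρ := by
      rw [Nat.add_mul_div_left _ _ (by omega), Nat.div_eq_of_lt he', zero_add]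
    rw [yatesIter, yatesStep, i1, i2, hm, Nat.add_mul_div_left _ _ (by positivity),
      Nat.div_eq_of_lt hb, zero_add, Nat.add_mul_mod_self_left, Nat.mod_eq_of_lt hb, sum_range_mul]
    simp only [yatesKernel, h1, h2]
    have hstep : ∀ it ∈ range din, ∀ e'' ∈ range E,
        K e' ρt (e'' + E * it) * yatesIter E din dout K q X t
          (e'' + E * it + E * din * (r + din ^ (q - t) * ρ')) =
        ∑ e ∈ range E, ∑ i ∈ range (din ^ t), K e' ρt (e'' + E * it) *
          yatesKernel E din dout K t e'' ρ' e i *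
            X (e + E * (i + din ^ t * it + din ^ (t + 1) * r)) := by
      intro it hit e'' he''
      have h3 : it + din * r < din ^ (q + 1 - t) := by
        rw [hq', pow_succ']
        calc it + din * r < din * (r + 1) := by
              rw [Nat.mul_succ]; have := Finset.mem_range.1 hit; omega
          _ ≤ _ := Nat.mul_le_mul_left _ hr
      have h4 := ih (by omega) e'' (it + din * r) ρ' (Finset.mem_range.1 he'') h3 hρ'
      rw [show e'' + E * it + E * din * (r + din ^ (q - t) * ρ') =
        e'' + E * (it + din * r + din ^ (q + 1 - t) * ρ') by rw [hq']; ring, h4, Finset.mul_sum]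
      refine Finset.sum_congr rfl fun e _ => ?_
      rw [Finset.mul_sum]
      refine Finset.sum_congr rfl fun i _ => ?_
      rw [mul_assoc]
      congr 3
      ring
    rw [Finset.sum_congr rfl fun it hit => Finset.sum_congr rfl fun e'' he'' =>
      hstep it hit e'' he'']
    have hR : ∀ e ∈ range E, ∑ i ∈ range (din ^ (t + 1)),
        (∑ e'' ∈ range E, K e' ρt (e'' + E * (i / din ^ t)) *
          yatesKernel E din dout K t e'' ρ' e (i % din ^ t)) * X (e + E * (i + din ^ (t + 1) * r)) =
        ∑ it ∈ range din, ∑ e'' ∈ range E, ∑ i ∈ range (din ^ t),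
          K e' ρt (e'' + E * it) * yatesKernel E din dout K t e'' ρ' e i *
            X (e + E * (i + din ^ t * it + din ^ (t + 1) * r)) := by
      intro e _
      rw [pow_succ, sum_range_mul]
      refine Finset.sum_congr rfl fun it _ => ?_
      rw [Finset.sum_comm]
      refine Finset.sum_congr rfl fun i hi => ?_
      have hi := Finset.mem_range.1 hi
      rw [Nat.add_mul_div_left _ _ (by omega), Nat.div_eq_of_lt hi, zero_add,
        Nat.add_mul_mod_self_left, Nat.mod_eq_of_lt hi, Finset.sum_mul]
    rw [Finset.sum_congr rfl hR]
    symm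
    rw [Finset.sum_comm]
    refine Finset.sum_congr rfl fun it _ => ?_
    rw [Finset.sum_comm]

theorem yatesIter_full (E din dout : ℕ) (K : ℕ → ℕ → ℕ → ℤ) (q : ℕ) (X : ℕ → ℤ) (e' ρ : ℕ) (he' : e' < E) (hρ : ρ < dout ^ (q + 1)) :
    yatesIter E din dout K q X (q + 1) (e' + E * ρ) =
      ∑ e ∈ range E, ∑ i ∈ range (din ^ (q + 1)),
        yatesKernel E din dout K (q + 1) e' ρ e i * X (e + E * i) := by
  have := yatesIter_eq E din dout K q X (q + 1) le_rfl e' 0 ρ he' (by simp) hρ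
  simpa using this

/-! ### The bilinear algorithm for words of blocks -/

namespace BlockDecomposition

variable {s R D : ℕ} (B : BlockDecomposition s R D)

/-- The matrix for the first factor; the bond keeps the class of the lower blocks of the second
factor. -/
def KU (e' ρ c : ℕ) : ℤ :=
  if classOfNat e' = classOfNat (c % 4) + B.cls ρ then
    B.U ρ (c / 4) * sgn (classDot (classOfNat (c % 4)) (wordClass s (c / 4))) else 0

def KV (_e ρ b : ℕ) : ℤ := B.V ρ b

def KW (_e c ρ : ℕ) : ℤ := B.W c ρ

/-- Induction that splits off the highest block. The inner bond `e''` must equal the class of the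
lower blocks of `j`, which supplies the cross sign of `wordTensor_add`. Keeping the final bond `e'`
separate, with its class condition, is what lets the induction close. -/
theorem sum_kernel (t e' i j k : ℕ) (he' : e' < 4) (hi : i < (6 ^ s) ^ t) (hj : j < (6 ^ s) ^ t)
    (hk : k < (6 ^ s) ^ t) :
    ∑ ρ ∈ range (R ^ t), yatesKernel 4 (6 ^ s) R B.KU t e' ρ 0 i *
      yatesKernel 1 (6 ^ s) R B.KV t 0 ρ 0 j * yatesKernel 1 R (6 ^ s) B.KW t 0 k 0 ρ =
    if classOfNat e' = wordClass (s * t) j then D ^ t * wordTensor (s * t) i j k else 0 := by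
  induction t generalizing e' i j k with
  | zero =>
    have h0 : ∀ e < 4, classOfNat e = 0 ↔ e = 0 := by decide
    simp [yatesKernel, wordClass, wordTensor, joinTensor, inversions, sgn_zero, ← Prod.zero_eq_mk,
      h0 _ he']
  | succ t ih =>
    have hd : 0 < 6 ^ s := by positivity
    have hdt : 0 < (6 ^ s) ^ t := by positivity
    have e6 : (6 ^ s) ^ t = 6 ^ (s * t) := (pow_mul 6 s t).symm
    have split : ∀ {i}, i < (6 ^ s) ^ (t + 1) → ∃ i' a, i' < (6 ^ s) ^ t ∧ a < 6 ^ s ∧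
        i % (6 ^ s) ^ t = i' ∧ i / (6 ^ s) ^ t = a ∧ i = i' + 6 ^ (s * t) * a := fun {i} hi =>
      ⟨_, _, Nat.mod_lt _ hdt, Nat.div_lt_of_lt_mul (by rwa [← pow_succ]), rfl, rfl, by
        rw [← e6, Nat.mod_add_div]⟩
    obtain ⟨i', a, hi', ha, i1, i2, i3⟩ := split hi
    obtain ⟨j', b, hj', hb, j1, j2, j3⟩ := split hj
    obtain ⟨k', c, hk', hc, k1, k2, k3⟩ := split hk
    rw [pow_succ R, sum_range_mul]
    have h1 : ∀ ρt ∈ range R, ∑ ρ ∈ range (R ^ t),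
        yatesKernel 4 (6 ^ s) R B.KU (t + 1) e' (ρ + R ^ t * ρt) 0 i *
        yatesKernel 1 (6 ^ s) R B.KV (t + 1) 0 (ρ + R ^ t * ρt) 0 j *
        yatesKernel 1 R (6 ^ s) B.KW (t + 1) 0 k 0 (ρ + R ^ t * ρt) =
        if classOfNat e' = wordClass (s * t) j' + wordClass s b then
          B.U ρt a * B.V ρt b * B.W c ρt *
            (D ^ t * wordTensor (s * t) i' j' k' *
              sgn (classDot (wordClass (s * t) j') (wordClass s a))) else 0 := by
      intro ρt hρt
      have hsum : ∀ ρ ∈ range (R ^ t),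
          yatesKernel 4 (6 ^ s) R B.KU (t + 1) e' (ρ + R ^ t * ρt) 0 i *
          yatesKernel 1 (6 ^ s) R B.KV (t + 1) 0 (ρ + R ^ t * ρt) 0 j *
          yatesKernel 1 R (6 ^ s) B.KW (t + 1) 0 k 0 (ρ + R ^ t * ρt) =
          ∑ e'' ∈ range 4, B.KU e' ρt (e'' + 4 * a) * B.V ρt b * B.W c ρt *
            (yatesKernel 4 (6 ^ s) R B.KU t e'' ρ 0 i' *
            yatesKernel 1 (6 ^ s) R B.KV t 0 ρ 0 j' * yatesKernel 1 R (6 ^ s) B.KW t 0 k' 0 ρ) := by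
        intro ρ hρ
        have hρ := Finset.mem_range.1 hρ
        have r1 : (ρ + R ^ t * ρt) / R ^ t = ρt := by
          rw [Nat.add_mul_div_left _ _ (by omega), Nat.div_eq_of_lt hρ, zero_add]
        have r2 : (ρ + R ^ t * ρt) % R ^ t = ρ := by
          rw [Nat.add_mul_mod_self_left, Nat.mod_eq_of_lt hρ]
        simp only [yatesKernel, r1, r2, i1, i2, j1, j2, k1, k2, Finset.sum_range_one, zero_add,
          one_mul, Finset.sum_mul]
        refine Finset.sum_congr rfl fun e'' _ => ?_
        simp only [KV, KW]
        ring
      rw [Finset.sum_congr rfl hsum, Finset.sum_comm]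
      have h2 : ∀ e'' ∈ range 4, ∑ ρ ∈ range (R ^ t),
          B.KU e' ρt (e'' + 4 * a) * B.V ρt b * B.W c ρt *
            (yatesKernel 4 (6 ^ s) R B.KU t e'' ρ 0 i' *
            yatesKernel 1 (6 ^ s) R B.KV t 0 ρ 0 j' * yatesKernel 1 R (6 ^ s) B.KW t 0 k' 0 ρ) =
          if classOfNat e'' = wordClass (s * t) j' then
            (if classOfNat e' = classOfNat e'' + B.cls ρt then
              B.U ρt a * B.V ρt b * B.W c ρt * (D ^ t * wordTensor (s * t) i' j' k' *
                sgn (classDot (classOfNat e'') (wordClass s a))) else 0) else 0 := by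
        intro e'' he''
        have he'' := Finset.mem_range.1 he''
        rw [← Finset.mul_sum, ih e'' i' j' k' he'' hi' hj' hk', KU,
          Nat.add_mul_mod_self_left, Nat.mod_eq_of_lt he'', Nat.add_mul_div_left _ _ (by norm_num),
          Nat.div_eq_of_lt he'', zero_add]
        split_ifs <;> ring
      rw [Finset.sum_congr rfl h2, sum_range_four_classOfNat (wordClass (s * t) j') (fun p =>
        if classOfNat e' = p + B.cls ρt then
              B.U ρt a * B.V ρt b * B.W c ρt * (D ^ t * wordTensor (s * t) i' j' k' *
                sgn (classDot p (wordClass s a))) else 0)]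
      -- A term that does not vanish knows the class of `b`, so the bond is updated by the right
      -- amount.
      by_cases hV : B.V ρt b = 0
      · simp [hV]
      · rw [B.cls_eq _ _ hV]
    rw [Finset.sum_congr rfl h1, Nat.mul_succ, i3, j3, k3, wordTensor_add _ _ _ (by rwa [← e6])
      (by rwa [← e6]) (by rwa [← e6]), wordClass_add _ (by rwa [← e6])]
    split_ifs
    · rw [← Finset.sum_mul, B.sum_eq a ha b hb c hc]
      ring
    · simp

/-- The result of the three transforms. -/
theorem transform_eq (q : ℕ) (X Y A P : ℕ → ℤ)
    (hA : ∀ i < (6 ^ s) ^ (q + 1), ∀ e < 4, A (e + 4 * i) = if e = 0 then X i else 0)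
    (hP : ∀ ρ < R ^ (q + 1), P ρ =
      (∑ e ∈ range 4, yatesIter 4 (6 ^ s) R B.KU q A (q + 1) (e + 4 * ρ)) *
        yatesIter 1 (6 ^ s) R B.KV q Y (q + 1) ρ)
    (k : ℕ) (hk : k < (6 ^ s) ^ (q + 1)) :
    yatesIter 1 R (6 ^ s) B.KW q P (q + 1) k = D ^ (q + 1) *
      ∑ i ∈ range ((6 ^ s) ^ (q + 1)), ∑ j ∈ range ((6 ^ s) ^ (q + 1)),
        X i * Y j * wordTensor (s * (q + 1)) i j k := by
  have h1 := yatesIter_full 1 R (6 ^ s) B.KW q P 0 k one_pos hk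
  simp only [zero_add, one_mul, Finset.sum_range_one] at h1
  -- The bond starts at the class of the empty word, so only `e = 0` contributes to the input.
  have hU : ∀ e < 4, ∀ ρ < R ^ (q + 1), yatesIter 4 (6 ^ s) R B.KU q A (q + 1) (e + 4 * ρ) =
      ∑ i ∈ range ((6 ^ s) ^ (q + 1)), yatesKernel 4 (6 ^ s) R B.KU (q + 1) e ρ 0 i * X i := by
    intro e he ρ hρ
    rw [yatesIter_full 4 (6 ^ s) R B.KU q A e ρ he hρ,
      Finset.sum_eq_single_of_mem 0 (by simp)]
    · refine Finset.sum_congr rfl fun i hi => ?_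
      rw [hA i (Finset.mem_range.1 hi) 0 (by norm_num), if_pos rfl]
    · intro e he hne
      refine Finset.sum_eq_zero fun i hi => ?_
      rw [hA i (Finset.mem_range.1 hi) e (Finset.mem_range.1 he), if_neg hne, mul_zero]
  have hV : ∀ ρ < R ^ (q + 1), yatesIter 1 (6 ^ s) R B.KV q Y (q + 1) ρ =
      ∑ j ∈ range ((6 ^ s) ^ (q + 1)), yatesKernel 1 (6 ^ s) R B.KV (q + 1) 0 ρ 0 j * Y j := by
    intro ρ hρ
    have := yatesIter_full 1 (6 ^ s) R B.KV q Y 0 ρ one_pos hρ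
    simpa only [zero_add, one_mul, Finset.sum_range_one] using this
  have h2 : ∀ ρ ∈ range (R ^ (q + 1)), yatesKernel 1 R (6 ^ s) B.KW (q + 1) 0 k 0 ρ * P ρ =
      ∑ i ∈ range ((6 ^ s) ^ (q + 1)), ∑ j ∈ range ((6 ^ s) ^ (q + 1)), ∑ e ∈ range 4,
        X i * Y j * (yatesKernel 4 (6 ^ s) R B.KU (q + 1) e ρ 0 i *
      yatesKernel 1 (6 ^ s) R B.KV (q + 1) 0 ρ 0 j *
      yatesKernel 1 R (6 ^ s) B.KW (q + 1) 0 k 0 ρ) := by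
    intro ρ hρ
    have hρ := Finset.mem_range.1 hρ
    rw [hP ρ hρ, hV ρ hρ, Finset.sum_congr rfl fun e he => hU e (Finset.mem_range.1 he) ρ hρ,
      Finset.sum_comm, Finset.sum_mul_sum, Finset.mul_sum]
    refine Finset.sum_congr rfl fun i _ => ?_
    rw [Finset.mul_sum]
    refine Finset.sum_congr rfl fun j _ => ?_
    rw [Finset.sum_mul, Finset.mul_sum]
    exact Finset.sum_congr rfl fun e _ => by ring
  rw [h1, Finset.sum_congr rfl h2, Finset.sum_comm, Finset.mul_sum]
  refine Finset.sum_congr rfl fun i hi => ?_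
  rw [Finset.sum_comm, Finset.mul_sum]
  refine Finset.sum_congr rfl fun j hj => ?_
  rw [Finset.sum_comm]
  have h3 : ∀ e ∈ range 4, ∑ ρ ∈ range (R ^ (q + 1)),
      X i * Y j * (yatesKernel 4 (6 ^ s) R B.KU (q + 1) e ρ 0 i *
      yatesKernel 1 (6 ^ s) R B.KV (q + 1) 0 ρ 0 j *
      yatesKernel 1 R (6 ^ s) B.KW (q + 1) 0 k 0 ρ) =
      if classOfNat e = wordClass (s * (q + 1)) j then
        X i * Y j * (D ^ (q + 1) * wordTensor (s * (q + 1)) i j k) else 0 := by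
    intro e he
    rw [← Finset.mul_sum, B.sum_kernel _ _ _ _ _ (Finset.mem_range.1 he) (Finset.mem_range.1 hi)
      (Finset.mem_range.1 hj) hk, mul_ite, mul_zero]
  -- Summing over the final bond removes the class condition, as exactly one bond matches `j`.
  rw [Finset.sum_congr rfl h3, sum_range_four_classOfNat (wordClass (s * (q + 1)) j) (fun _ =>
    X i * Y j * (D ^ (q + 1) * wordTensor (s * (q + 1)) i j k))]
  ring

end BlockDecomposition

/-! ### Bit lengths and the cost of expressions -/

theorem bitLength_le_iff {z : ℤ} {β : ℕ} : bitLength z ≤ β ↔ |z| < 2 ^ β := by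
  rw [bitLength, Nat.size_le, Int.abs_eq_natAbs]
  exact_mod_cast Iff.rfl

theorem bitLength_eval_le (o : RamOp) (x y : ℤ) :
    bitLength (o.eval x y) ≤ bitLength x + bitLength y + 1 := by
  have hx : |x| < 2 ^ bitLength x := bitLength_le_iff.1 le_rfl
  have hy : |y| < 2 ^ bitLength y := bitLength_le_iff.1 le_rfl
  have h1 : (1 : ℤ) ≤ 2 ^ bitLength x := one_le_pow₀ (by norm_num)
  have h2 : (1 : ℤ) ≤ 2 ^ bitLength y := one_le_pow₀ (by norm_num)
  rw [bitLength_le_iff, pow_succ, pow_add]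
  cases o
  · have := abs_add_le x y
    simp only [RamOp.eval]
    nlinarith
  · have := abs_sub x y
    simp only [RamOp.eval]
    nlinarith
  · simp only [RamOp.eval, abs_mul]
    nlinarith [abs_nonneg x, abs_nonneg y]
  · have : |x / y| ≤ |x| := by
      rw [Int.abs_eq_natAbs, Int.abs_eq_natAbs]
      exact_mod_cast Int.natAbs_ediv_le_natAbs x y
    simp only [RamOp.eval]
    nlinarith

/-- All cells have at most `β` bits. -/
def BitsLE (β : ℕ) (s : RamState) : Prop := ∀ a i, bitLength (s a i) ≤ β

/-- An expression of the program is fixed, so its size enters only through the constant `w`. Lengths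
grow linearly in `β`; the cost is quadratic because an operation is charged the product of the
lengths. -/
theorem RamExpr.exists_cost_le (e : RamExpr) : ∃ w : ℕ, ∀ (s : RamState) (β : ℕ), BitsLE β s →
    bitLength (e.eval s) ≤ w * (β + 1) ∧ e.cost s ≤ w * (β + 1) ^ 2 := by
  induction e with
  | const z =>
    refine ⟨1 + bitLength z, fun s β _ => ⟨?_, ?_⟩⟩
    · simp only [RamExpr.eval]; nlinarith
    · simp only [RamExpr.cost]; exact Nat.le_mul_of_pos_right _ (by positivity)
  | read a e ih =>
    obtain ⟨w, hw⟩ := ih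
    refine ⟨2 * w + 1, fun s β hs => ⟨?_, ?_⟩⟩
    · have := hs a (e.eval s)
      simp only [RamExpr.eval]
      nlinarith
    · have h1 := hs a (e.eval s)
      obtain ⟨h2, h3⟩ := hw s β hs
      simp only [RamExpr.cost]
      nlinarith [Nat.zero_le (w * β), Nat.zero_le (w * β ^ 2)]
  | op o e₁ e₂ ih₁ ih₂ =>
    obtain ⟨w₁, hw₁⟩ := ih₁
    obtain ⟨w₂, hw₂⟩ := ih₂
    refine ⟨w₁ + w₂ + (1 + w₁) * (1 + w₂), fun s β hs => ?_⟩
    obtain ⟨h1, h2⟩ := hw₁ s β hs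
    obtain ⟨h3, h4⟩ := hw₂ s β hs
    constructor
    · have := bitLength_eval_le o (e₁.eval s) (e₂.eval s)
      simp only [RamExpr.eval]
      nlinarith [Nat.zero_le (w₁ * w₂ * (β + 1)), Nat.zero_le (w₁ * (β + 1)),
        Nat.zero_le (w₂ * (β + 1))]
    · simp only [RamExpr.cost]
      have h5 : (1 + bitLength (e₁.eval s)) * (1 + bitLength (e₂.eval s)) ≤
          ((1 + w₁) * (β + 1)) * ((1 + w₂) * (β + 1)) :=
        Nat.mul_le_mul (by nlinarith) (by nlinarith)
      calc _ ≤ w₁ * (β + 1) ^ 2 + w₂ * (β + 1) ^ 2 +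
            ((1 + w₁) * (β + 1)) * ((1 + w₂) * (β + 1)) := by gcongr
        _ = _ := by ring

/-! ### States -/

theorem RamState.store_self (s : RamState) (a : ℕ) (i z : ℤ) : s.store a i z a i = z := by
  simp [RamState.store]

theorem RamState.store_of_ne (s : RamState) {a b : ℕ} (h : b ≠ a) (i z : ℤ) :
    s.store a i z b = s b := by
  funext j
  simp [RamState.store, h]

theorem RamState.store_of_ne_index (s : RamState) (a : ℕ) {i j : ℤ} (h : j ≠ i) (z : ℤ) :
    s.store a i z a j = s a j := by
  simp [RamState.store, h]

theorem BitsLE.store {β : ℕ} {s : RamState} (h : BitsLE β s) (a : ℕ) (i : ℤ) {z : ℤ}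
    (hz : bitLength z ≤ β) : BitsLE β (s.store a i z) := by
  intro b j
  simp only [RamState.store]
  split_ifs
  · exact hz
  · exact h b j

/-! ### Total correctness with a time bound -/

/-- Started in `s`, the program halts within time `T` in a state with the property `Q`. -/
def Ends (p : RamProgram) (s : RamState) (T : ℕ) (Q : RamState → Prop) : Prop :=
  ∃ t s', Runs p s t s' ∧ t ≤ T ∧ Q s'

theorem Ends.mono {p : RamProgram} {s : RamState} {T T' : ℕ} {Q Q' : RamState → Prop}
    (h : Ends p s T Q) (hT : T ≤ T') (hQ : ∀ s', Q s' → Q' s') : Ends p s T' Q' := by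
  obtain ⟨t, s', h1, h2, h3⟩ := h
  exact ⟨t, s', h1, h2.trans hT, hQ _ h3⟩

theorem Ends.seq {p q : RamProgram} {s : RamState} {T T' : ℕ} {Q Q' : RamState → Prop}
    (h : Ends p s T Q) (h' : ∀ s', Q s' → Ends q s' T' Q') : Ends (.seq p q) s (T + T') Q' := by
  obtain ⟨t, s', h1, h2, h3⟩ := h
  obtain ⟨t', s'', h4, h5, h6⟩ := h' s' h3
  exact ⟨t + t', s'', .seq h1 h4, by omega, h6⟩

theorem ends_assign (a : ℕ) (idx e : RamExpr) : ∃ w : ℕ, ∀ (s : RamState) (β : ℕ)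
    (Q : RamState → Prop), BitsLE β s → Q (s.store a (idx.eval s) (e.eval s)) →
      Ends (.assign a idx e) s (w * (β + 1) ^ 2) Q := by
  obtain ⟨w₁, h₁⟩ := idx.exists_cost_le
  obtain ⟨w₂, h₂⟩ := e.exists_cost_le
  refine ⟨2 * w₁ + 2 * w₂ + 1, fun s β Q hs hQ => ⟨_, _, .assign a idx e s, ?_, hQ⟩⟩
  obtain ⟨h3, h4⟩ := h₁ s β hs
  obtain ⟨h5, h6⟩ := h₂ s β hs
  nlinarith [Nat.zero_le (w₁ * β), Nat.zero_le (w₁ * β ^ 2), Nat.zero_le (w₂ * β),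
    Nat.zero_le (w₂ * β ^ 2)]

/-- The scalar variable kept in cell `0` of the array `a`. -/
def reg (a : ℕ) : RamExpr := .read a (.const 0)

theorem reg_eval (a : ℕ) (s : RamState) : (reg a).eval s = s a 0 := rfl

/-- Run the body for the values `0, 1, …, len - 1` of the scalar variable `cnt`. -/
def forLoop (cnt : ℕ) (len : RamExpr) (body : RamProgram) : RamProgram :=
  .seq (.assign cnt (.const 0) (.const 0))
    (.whilePos (.op .sub len (reg cnt))
      (.seq body (.assign cnt (.const 0) (.op .add (reg cnt) (.const 1)))))

/-- The invariant `I t` is attached to the loop test with counter `t`. The length is evaluated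
afresh at each of the `n + 1` tests, so the invariant has to fix its value. -/
theorem ends_forLoop (cnt : ℕ) (len : RamExpr) (body : RamProgram) : ∃ w : ℕ,
    ∀ (s : RamState) (β n T : ℕ) (I : ℕ → RamState → Prop), BitsLE β s →
      I 0 (s.store cnt 0 0) →
      (∀ t ≤ n, ∀ s', I t s' → BitsLE β s' ∧ s' cnt 0 = t ∧ len.eval s' = n) →
      (∀ t < n, ∀ s', I t s' → Ends body s' T fun s'' =>
        BitsLE β s'' ∧ s'' cnt 0 = t ∧ I (t + 1) (s''.store cnt 0 (t + 1))) →
      Ends (forLoop cnt len body) s (n * T + (n + 1) * (w * (β + 1) ^ 2)) (I n) := by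
  obtain ⟨w₁, h₁⟩ := ends_assign cnt (.const 0) (.const 0)
  obtain ⟨w₂, h₂⟩ := ends_assign cnt (.const 0) (.op .add (reg cnt) (.const 1))
  obtain ⟨w₃, h₃⟩ := (RamExpr.op .sub len (reg cnt)).exists_cost_le
  refine ⟨w₁ + w₂ + w₃, fun s β n T I hs h0 hI hbody => ?_⟩
  have hw : ∀ k t, t + k = n → ∀ s', I t s' → Ends
      (.whilePos (.op .sub len (reg cnt))
        (.seq body (.assign cnt (.const 0) (.op .add (reg cnt) (.const 1))))) s'
      (k * T + (k + 1) * ((w₂ + w₃) * (β + 1) ^ 2)) (I n) := by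
    intro k
    induction k with
    | zero =>
      intro t ht s' hs'
      obtain ⟨b1, b2, b3⟩ := hI t (by omega) s' hs'
      refine ⟨_, s', .while_done ?_, ?_, ?_⟩
      · simp only [RamExpr.eval, RamOp.eval, reg_eval, b2, b3]
        omega
      · have := (h₃ s' β b1).2
        nlinarith [Nat.zero_le (w₂ * (β + 1) ^ 2)]
      · rwa [← ht]
    | succ k ih =>
      intro t ht s' hs'
      obtain ⟨b1, b2, b3⟩ := hI t (by omega) s' hs'
      obtain ⟨t1, s1, r1, l1, q1⟩ := (hbody t (by omega) s' hs').seq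
        (T' := w₂ * (β + 1) ^ 2) (Q' := I (t + 1)) (fun s'' hs'' => by
          refine h₂ s'' β _ hs''.1 ?_
          have : (RamExpr.op .add (reg cnt) (.const 1)).eval s'' = t + 1 := by
            simp [RamExpr.eval, RamOp.eval, reg_eval, hs''.2.1]
          rw [this]
          exact hs''.2.2)
      obtain ⟨t2, s2, r2, l2, q2⟩ := ih (t + 1) (by omega) s1 q1
      refine ⟨_, s2, .while_step ?_ r1 r2, ?_, q2⟩
      · simp only [RamExpr.eval, RamOp.eval, reg_eval, b2, b3]
        omega
      · have := (h₃ s' β b1).2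
        nlinarith
  refine ((h₁ s β (I 0) hs h0).seq (hw n 0 (by omega))).mono ?_ fun _ h => h
  nlinarith [Nat.zero_le (n * w₁ * (β + 1) ^ 2)]

/-- Put the value of `e` into the cells `0, 1, …, len - 1` of the array `dst`; the expression
may use the index, which is the value of the scalar variable `cnt`. -/
def mapLoop (cnt dst : ℕ) (len e : RamExpr) : RamProgram :=
  forLoop cnt len (.assign dst (reg cnt) e)

/-- The value of `e` is required in every state agreeing with `s` off `cnt` and `dst`, so cells
already overwritten cannot matter. The last clause preserves bounds on the cells beyond the written
range. -/
theorem ends_mapLoop {cnt dst : ℕ} (hne : cnt ≠ dst) (len e : RamExpr) : ∃ w : ℕ,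
    ∀ (s : RamState) (β n : ℕ) (v : ℕ → ℤ), BitsLE β s →
      (∀ s' : RamState, (∀ a, a ≠ cnt → a ≠ dst → s' a = s a) → len.eval s' = n) →
      (∀ i < n, ∀ s' : RamState, (∀ a, a ≠ cnt → a ≠ dst → s' a = s a) → s' cnt 0 = i →
        e.eval s' = v i) →
      (∀ i < n, bitLength (v i) ≤ β) → bitLength n ≤ β →
      Ends (mapLoop cnt dst len e) s (w * ((n + 1) * (β + 1) ^ 2)) fun s' =>
        BitsLE β s' ∧ (∀ a, a ≠ cnt → a ≠ dst → s' a = s a) ∧ (∀ i < n, s' dst (i : ℕ) = v i) ∧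
          ∀ j : ℤ, (∀ i < n, j ≠ (i : ℕ)) → s' dst j = s dst j := by
  obtain ⟨w₁, h₁⟩ := ends_forLoop cnt len (.assign dst (reg cnt) e)
  obtain ⟨w₂, h₂⟩ := ends_assign dst (reg cnt) e
  refine ⟨w₁ + w₂, fun s β n v hs hlen he hv hn => ?_⟩
  let J : ℕ → RamState → Prop := fun t s' =>
    BitsLE β s' ∧ (∀ a, a ≠ cnt → a ≠ dst → s' a = s a) ∧ (∀ i < t, s' dst (i : ℕ) = v i) ∧
      ∀ j : ℤ, (∀ i < t, j ≠ (i : ℕ)) → s' dst j = s dst j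
  have hJ : ∀ t s' z, bitLength z ≤ β → J t s' → J t (s'.store cnt 0 z) := by
    rintro t s' z hz ⟨b1, b2, b3, b4⟩
    refine ⟨b1.store _ _ hz, fun a h1 h2 => ?_, ?_, ?_⟩
    · rw [RamState.store_of_ne _ h1, b2 a h1 h2]
    · simpa only [RamState.store_of_ne _ hne.symm] using b3
    · simpa only [RamState.store_of_ne _ hne.symm] using b4
  have hcast : ∀ t ≤ n, bitLength (t : ℤ) ≤ β := by
    intro t ht
    rw [bitLength_le_iff] at hn ⊢
    refine lt_of_le_of_lt ?_ hn
    rw [Nat.abs_cast, Nat.abs_cast]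
    exact_mod_cast ht
  have := h₁ s β n (w₂ * (β + 1) ^ 2) (fun t s' => J t s' ∧ s' cnt 0 = t) hs
    ⟨hJ 0 s 0 (by simp [bitLength]) ⟨hs, fun _ _ _ => rfl, by simp, fun _ _ => rfl⟩,
      by simp [RamState.store_self]⟩
    (fun t _ s' hs' => ⟨hs'.1.1, hs'.2, hlen s' hs'.1.2.1⟩)
    (fun t ht s' hs' => by
      obtain ⟨⟨b1, b2, b3, b4⟩, hc⟩ := hs'
      refine h₂ s' β _ b1 ?_
      rw [reg_eval, hc, he t ht s' b2 hc]
      have b5 := b1.store dst (t : ℤ) (hv t ht)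
      refine ⟨b5, by rw [RamState.store_of_ne _ hne, hc], hJ _ _ _ ?_ ⟨b5, ?_, ?_, ?_⟩,
        by rw [RamState.store_self]; push_cast; rfl⟩
      · exact_mod_cast hcast (t + 1) ht
      · intro a h1 h2
        rw [RamState.store_of_ne _ h2, b2 a h1 h2]
      · intro i hi
        rcases Nat.lt_succ_iff_lt_or_eq.1 hi with hi | rfl
        · rw [RamState.store_of_ne_index _ _ (by exact_mod_cast hi.ne), b3 i hi]
        · rw [RamState.store_self]
      · intro j hj
        rw [RamState.store_of_ne_index _ _ (hj t (by omega)), b4 j fun i hi => hj i (by omega)])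
  refine this.mono ?_ fun s' hs' => hs'.1
  nlinarith [Nat.zero_le (w₂ * (β + 1) ^ 2)]

/-- Store the `len`-th power of the constant `b` in the scalar variable `dst`. -/
def powLoop (cnt dst : ℕ) (len : RamExpr) (b : ℕ) : RamProgram :=
  .seq (.assign dst (.const 0) (.const 1))
    (forLoop cnt len (.assign dst (.const 0) (.op .mul (reg dst) (.const b))))

theorem ends_powLoop {cnt dst : ℕ} (hne : cnt ≠ dst) (len : RamExpr) (b : ℕ) : ∃ w : ℕ,
    ∀ (s : RamState) (β n : ℕ), BitsLE β s →
      (∀ s' : RamState, (∀ a, a ≠ cnt → a ≠ dst → s' a = s a) → len.eval s' = n) →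
      (∀ i ≤ n, bitLength ((b : ℤ) ^ i) ≤ β) → bitLength n ≤ β →
      Ends (powLoop cnt dst len b) s (w * ((n + 1) * (β + 1) ^ 2)) fun s' =>
        BitsLE β s' ∧ (∀ a, a ≠ cnt → a ≠ dst → s' a = s a) ∧ s' dst 0 = (b : ℤ) ^ n := by
  obtain ⟨w₀, h₀⟩ := ends_assign dst (.const 0) (.const 1)
  obtain ⟨w₁, h₁⟩ := ends_forLoop cnt len
    (.assign dst (.const 0) (.op .mul (reg dst) (.const b)))
  obtain ⟨w₂, h₂⟩ := ends_assign dst (.const 0) (.op .mul (reg dst) (.const b))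
  refine ⟨w₀ + w₁ + w₂, fun s β n hs hlen hb hn => ?_⟩
  have hcast : ∀ t ≤ n, bitLength (t : ℤ) ≤ β := by
    intro t ht
    rw [bitLength_le_iff] at hn ⊢
    refine lt_of_le_of_lt ?_ hn
    rw [Nat.abs_cast, Nat.abs_cast]
    exact_mod_cast ht
  let J : ℕ → RamState → Prop := fun t s' =>
    BitsLE β s' ∧ (∀ a, a ≠ cnt → a ≠ dst → s' a = s a) ∧ s' dst 0 = (b : ℤ) ^ t
  have hJ : ∀ t s' z, bitLength z ≤ β → J t s' → J t (s'.store cnt 0 z) := by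
    rintro t s' z hz ⟨b1, b2, b3⟩
    refine ⟨b1.store _ _ hz, fun a h1 h2 => ?_, ?_⟩
    · rw [RamState.store_of_ne _ h1, b2 a h1 h2]
    · rw [RamState.store_of_ne _ hne.symm, b3]
  have start := h₀ s β (J 0) hs ⟨hs.store _ _ (by simpa [RamExpr.eval] using hb 0 (Nat.zero_le _)),
    fun a _ h2 => RamState.store_of_ne _ h2 _ _, by
      simp only [RamExpr.eval, RamState.store_self, pow_zero]⟩
  have := start.seq fun s₁ hs₁ => h₁ s₁ β n (w₂ * (β + 1) ^ 2)
    (fun t s' => J t s' ∧ s' cnt 0 = t) hs₁.1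
    ⟨hJ 0 s₁ 0 (by simp [bitLength]) hs₁, by simp [RamState.store_self]⟩
    (fun t _ s' hs' => ⟨hs'.1.1, hs'.2, hlen s' hs'.1.2.1⟩)
    (fun t ht s' hs' => by
      obtain ⟨⟨b1, b2, b3⟩, hc⟩ := hs'
      refine h₂ s' β _ b1 ?_
      have hval : (RamExpr.op .mul (reg dst) (.const b)).eval s' = (b : ℤ) ^ (t + 1) := by
        simp only [RamExpr.eval, RamOp.eval, reg_eval, b3, pow_succ]
      rw [hval]
      have b5 := b1.store dst 0 (hb (t + 1) ht)
      refine ⟨b5, by rw [RamState.store_of_ne _ hne, hc], hJ _ _ _ ?_ ⟨b5, ?_, ?_⟩,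
        by rw [RamState.store_self]; push_cast; rfl⟩
      · exact_mod_cast hcast (t + 1) ht
      · intro a h1 h2
        rw [RamState.store_of_ne _ h2, b2 a h1 h2]
      · rw [RamExpr.eval, RamState.store_self])
  refine this.mono ?_ fun s' hs' => hs'.1
  nlinarith [Nat.zero_le (w₂ * (β + 1) ^ 2), Nat.zero_le (n * w₀ * (β + 1) ^ 2)]

/-! ### Expressions -/

def sumExpr (F : ℕ → RamExpr) : ℕ → RamExpr
  | 0 => .const 0
  | n + 1 => .op .add (sumExpr F n) (F n)

theorem sumExpr_eval (F : ℕ → RamExpr) (n : ℕ) (s : RamState) :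
    (sumExpr F n).eval s = ∑ i ∈ range n, (F i).eval s := by
  induction n with
  | zero => rfl
  | succ n ih => rw [Finset.sum_range_succ, ← ih]; rfl

/-- The expression is `1` if the value of `x` is `k`, and `0` otherwise. -/
def indicatorExpr (k : ℕ) (x : RamExpr) : RamExpr :=
  .op .div (.const 1) (.op .add (.const 1)
    (.op .mul (.op .sub x (.const k)) (.op .sub x (.const k))))

/-- The divisor `1 + (x - k) ^ 2` exceeds one unless `x = k`, so the integer quotient is an equality
test. -/
theorem indicatorExpr_eval {k a : ℕ} {x : RamExpr} {s : RamState} (h : x.eval s = a) :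
    (indicatorExpr k x).eval s = if k = a then 1 else 0 := by
  simp only [indicatorExpr, RamExpr.eval, RamOp.eval, h]
  split_ifs with hk
  · simp [hk]
  · have h0 : (a : ℤ) - k ≠ 0 := by omega
    have : 0 < ((a : ℤ) - k) * (a - k) := mul_self_pos.2 h0
    exact Int.ediv_eq_zero_of_lt (by norm_num) (by linarith)

/-- Hard-wires a finite table into the program; its size depends on the block only, not on `n`. -/
def tableExpr (m n : ℕ) (F : ℕ → ℕ → ℤ) (x y : RamExpr) : RamExpr :=
  sumExpr (fun i => sumExpr (fun j =>
    .op .mul (.const (F i j)) (.op .mul (indicatorExpr i x) (indicatorExpr j y))) n) m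

theorem tableExpr_eval {m n a b : ℕ} (F : ℕ → ℕ → ℤ) {x y : RamExpr} {s : RamState}
    (hx : x.eval s = a) (hy : y.eval s = b) (ha : a < m) (hb : b < n) :
    (tableExpr m n F x y).eval s = F a b := by
  rw [tableExpr, sumExpr_eval, Finset.sum_eq_single_of_mem a (Finset.mem_range.2 ha),
    sumExpr_eval, Finset.sum_eq_single_of_mem b (Finset.mem_range.2 hb)]
  · simp [RamExpr.eval, RamOp.eval, indicatorExpr_eval hx, indicatorExpr_eval hy]
  · intro j _ hj
    simp [RamExpr.eval, RamOp.eval, indicatorExpr_eval hy, hj]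
  · intro i _ hi
    rw [sumExpr_eval]
    exact Finset.sum_eq_zero fun j _ => by
      simp [RamExpr.eval, RamOp.eval, indicatorExpr_eval hx, hi]

def divExpr (x y : RamExpr) : RamExpr := .op .div x y

theorem divExpr_eval {a b : ℕ} {x y : RamExpr} {s : RamState} (hx : x.eval s = a)
    (hy : y.eval s = b) : (divExpr x y).eval s = ((a / b : ℕ) : ℤ) := by
  simp [divExpr, RamExpr.eval, RamOp.eval, hx, hy]

def modExpr (x y : RamExpr) : RamExpr := .op .sub x (.op .mul y (.op .div x y))

theorem modExpr_eval {a b : ℕ} {x y : RamExpr} {s : RamState} (hx : x.eval s = a)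
    (hy : y.eval s = b) : (modExpr x y).eval s = ((a % b : ℕ) : ℤ) := by
  simp [modExpr, RamExpr.eval, RamOp.eval, hx, hy, Int.emod_def]

/-! ### The program for the transform of the digits

Scalar variables: `4` is the number of blocks minus one, `8` the modulus `m` of the current step,
`9` and `10` are counters; array `13` is auxiliary. -/

def yatesExpr (E din dout : ℕ) (K : ℕ → ℕ → ℕ → ℤ) (src : ℕ) : RamExpr :=
  sumExpr (fun c => .op .mul
    (tableExpr E dout (fun e ρ => K e ρ c) (modExpr (reg 9) (.const E))
      (divExpr (divExpr (reg 9) (.const E)) (reg 8)))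
    (.read src (.op .add (.const c) (.op .mul (.const (E * din : ℕ))
      (modExpr (divExpr (reg 9) (.const E)) (reg 8)))))) (E * din)

theorem yatesExpr_eval {E din dout : ℕ} (K : ℕ → ℕ → ℕ → ℤ) {src m i : ℕ} {s : RamState}
    (h9 : s 9 0 = i) (h8 : s 8 0 = m) (hi : i < E * (dout * m)) :
    (yatesExpr E din dout K src).eval s =
      yatesStep E din K m (fun j => s src (j : ℕ)) i := by
  have hE : 0 < E := Nat.pos_of_ne_zero fun h => by simp [h] at hi
  have h1 : (divExpr (reg 9) (.const E)).eval s = ((i / E : ℕ) : ℤ) :=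
    divExpr_eval (by rw [reg_eval, h9]) rfl
  have h2 : (modExpr (reg 9) (.const E)).eval s = ((i % E : ℕ) : ℤ) :=
    modExpr_eval (by rw [reg_eval, h9]) rfl
  have h3 : (divExpr (divExpr (reg 9) (.const E)) (reg 8)).eval s = ((i / E / m : ℕ) : ℤ) :=
    divExpr_eval h1 (by rw [reg_eval, h8])
  have h4 : (modExpr (divExpr (reg 9) (.const E)) (reg 8)).eval s = ((i / E % m : ℕ) : ℤ) :=
    modExpr_eval h1 (by rw [reg_eval, h8])
  rw [yatesExpr, sumExpr_eval, yatesStep]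
  refine Finset.sum_congr rfl fun c _ => ?_
  simp only [RamExpr.eval, RamOp.eval]
  rw [tableExpr_eval _ h2 h3 (Nat.mod_lt _ hE), h4]
  · push_cast
    rfl
  · rw [Nat.div_div_eq_div_mul]
    refine Nat.div_lt_of_lt_mul ?_
    calc i < E * (dout * m) := hi
      _ = _ := by ring

/-- A new cell depends on several old ones, so a step is computed into array `13` and then copied
back. The modulus is updated by exchanging one factor `din` for `dout`. -/
def yatesProgram (E din dout : ℕ) (K : ℕ → ℕ → ℕ → ℤ) (src : ℕ) : RamProgram :=
  .seq (powLoop 9 8 (reg 4) din)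
    (forLoop 10 (.op .add (reg 4) (.const 1))
      (.seq (mapLoop 9 13 (.op .mul (.const (E * dout : ℕ)) (reg 8)) (yatesExpr E din dout K src))
        (.seq (mapLoop 9 src (.op .mul (.const (E * dout : ℕ)) (reg 8)) (.read 13 (reg 9)))
          (.assign 8 (.const 0) (.op .mul (.op .div (reg 8) (.const din)) (.const dout))))))

/-- A step multiplies the magnitude by at most a bound for the row sums of the matrix, so each block
adds `c` bits. -/
theorem abs_yatesStep_le {E din dout c m : ℕ} {K : ℕ → ℕ → ℕ → ℤ} {X : ℕ → ℤ} {M : ℤ} {i : ℕ}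
    (hc : ∀ e < E, ∀ ρ < dout, ∑ x ∈ range (E * din), |K e ρ x| ≤ 2 ^ c)
    (hX : ∀ j < E * (din * m), |X j| ≤ M) (hM : 0 ≤ M) (hi : i < E * (dout * m)) :
    |yatesStep E din K m X i| ≤ 2 ^ c * M := by
  have hE : 0 < E := Nat.pos_of_ne_zero fun h => by simp [h] at hi
  have hm : 0 < m := Nat.pos_of_ne_zero fun h => by simp [h] at hi
  refine (Finset.abs_sum_le_sum_abs _ _).trans ?_
  have h1 : ∀ x ∈ range (E * din), |K (i % E) (i / E / m) x * X (x + E * din * (i / E % m))| ≤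
      |K (i % E) (i / E / m) x| * M := by
    intro x hx
    rw [abs_mul]
    refine mul_le_mul_of_nonneg_left (hX _ ?_) (abs_nonneg _)
    have h2 := Finset.mem_range.1 hx
    have h3 : i / E % m + 1 ≤ m := Nat.mod_lt _ hm
    calc x + E * din * (i / E % m) < E * din * (i / E % m + 1) := by rw [Nat.mul_succ]; omega
      _ ≤ E * din * m := Nat.mul_le_mul_left _ h3
      _ = _ := mul_assoc _ _ _
  refine (Finset.sum_le_sum h1).trans ?_
  rw [← Finset.sum_mul]
  refine mul_le_mul_of_nonneg_right (hc _ (Nat.mod_lt _ hE) _ ?_) hM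
  rw [Nat.div_div_eq_div_mul]
  refine Nat.div_lt_of_lt_mul ?_
  calc i < E * (dout * m) := hi
    _ = _ := by ring

theorem bitLength_natCast_mono {a b β : ℕ} (hab : a ≤ b) (hb : bitLength b ≤ β) :
    bitLength a ≤ β := by
  rw [bitLength_le_iff, Nat.abs_cast] at hb ⊢
  exact lt_of_le_of_lt (by exact_mod_cast hab) hb

/-- Here `Λ` bounds the length of every array written in a step, `l` the bits of the input and `β`
the bits of everything that is stored. -/
theorem ends_yatesProgram {E din dout c src : ℕ} {K : ℕ → ℕ → ℕ → ℤ} (hE : 0 < E)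
    (hdin : 0 < din) (hdout : 0 < dout) (h4 : src ≠ 4) (h8 : src ≠ 8) (h9 : src ≠ 9)
    (h10 : src ≠ 10) (h13 : src ≠ 13)
    (hc : ∀ e < E, ∀ ρ < dout, ∑ x ∈ range (E * din), |K e ρ x| ≤ 2 ^ c) :
    ∃ w : ℕ, ∀ (s : RamState) (β q l Λ : ℕ), BitsLE β s → s 4 0 = q →
      (∀ t ≤ q, E * (dout ^ (t + 1) * din ^ (q - t)) ≤ Λ) → bitLength Λ ≤ β →
      bitLength (q + 1 : ℕ) ≤ β → (∀ i, |s src i| ≤ 2 ^ l) → c * (q + 1) + l < β →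
      Ends (yatesProgram E din dout K src) s (w * ((q + 2) * ((Λ + 1) * (β + 1) ^ 2))) fun s' =>
        BitsLE β s' ∧ (∀ a, a ≠ 8 → a ≠ 9 → a ≠ 10 → a ≠ 13 → a ≠ src → s' a = s a) ∧
        (∀ i, |s' src i| ≤ 2 ^ (c * (q + 1) + l)) ∧
        ∀ i < E * dout ^ (q + 1), s' src (i : ℕ) =
          yatesIter E din dout K q (fun j => s src (j : ℕ)) (q + 1) i := by
  obtain ⟨w₁, h₁⟩ := ends_powLoop (cnt := 9) (dst := 8) (by norm_num) (reg 4) din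
  obtain ⟨w₂, h₂⟩ := ends_mapLoop (cnt := 9) (dst := 13) (by norm_num)
    (.op .mul (.const (E * dout : ℕ)) (reg 8)) (yatesExpr E din dout K src)
  obtain ⟨w₃, h₃⟩ := ends_mapLoop (cnt := 9) (dst := src) h9.symm
    (.op .mul (.const (E * dout : ℕ)) (reg 8)) (.read 13 (reg 9))
  obtain ⟨w₄, h₄⟩ := ends_assign 8 (.const 0)
    (.op .mul (.op .div (reg 8) (.const din)) (.const dout))
  obtain ⟨w₅, h₅⟩ := ends_forLoop 10 (.op .add (reg 4) (.const 1))
      (.seq (mapLoop 9 13 (.op .mul (.const (E * dout : ℕ)) (reg 8)) (yatesExpr E din dout K src))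
        (.seq (mapLoop 9 src (.op .mul (.const (E * dout : ℕ)) (reg 8)) (.read 13 (reg 9)))
          (.assign 8 (.const 0) (.op .mul (.op .div (reg 8) (.const din)) (.const dout)))))
  refine ⟨w₁ + w₂ + w₃ + w₄ + w₅, fun s β q l Λ hs hq hΛ hΛβ hqβ hl hβ => ?_⟩
  set X : ℕ → ℤ := fun j => s src (j : ℕ)
  let J : ℕ → RamState → Prop := fun t s' => BitsLE β s' ∧
    (∀ a, a ≠ 8 → a ≠ 9 → a ≠ 10 → a ≠ 13 → a ≠ src → s' a = s a) ∧
    (∀ i, |s' src i| ≤ 2 ^ (c * t + l)) ∧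
    (∀ i < E * (dout ^ t * din ^ (q + 1 - t)), s' src (i : ℕ) = yatesIter E din dout K q X t i) ∧
    -- After the last step the modulus is not used any more, and the division that updates it need
    -- not be exact.
    (t ≤ q → s' 8 0 = (dout ^ t * din ^ (q - t) : ℕ))
  have hJ : ∀ t s' z, bitLength z ≤ β → J t s' → J t (s'.store 10 0 z) := by
    rintro t s' z hz ⟨b1, b2, b3, b4, b5⟩
    refine ⟨b1.store _ _ hz, fun a a8 a9 a10 a13 as => ?_, ?_, ?_, ?_⟩
    · rw [RamState.store_of_ne _ a10, b2 a a8 a9 a10 a13 as]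
    · simpa only [RamState.store_of_ne _ h10] using b3
    · simpa only [RamState.store_of_ne _ h10] using b4
    · simpa only [RamState.store_of_ne _ (show 8 ≠ 10 by norm_num)] using b5
  have hpow : ∀ i ≤ q, bitLength ((din : ℤ) ^ i) ≤ β := by
    intro i hi
    have : din ^ i ≤ Λ := by
      refine (Nat.pow_le_pow_right hdin hi).trans ((?_ : din ^ q ≤ _).trans (hΛ 0 (Nat.zero_le _)))
      simp only [zero_add, pow_one, Nat.sub_zero]
      rw [← mul_assoc]
      exact Nat.le_mul_of_pos_left _ (by positivity)
    exact_mod_cast bitLength_natCast_mono this hΛβ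
  have start := h₁ s β q hs (fun s' h => by
    rw [reg_eval, h 4 (by norm_num) (by norm_num), hq]) hpow
    (bitLength_natCast_mono (Nat.le_succ q) hqβ)
  have hlen : ∀ s' : RamState, s' 4 = s 4 →
      (RamExpr.op .add (reg 4) (.const 1)).eval s' = (q + 1 : ℕ) := by
    intro s' h
    simp only [RamExpr.eval, RamOp.eval, reg_eval, h, hq]
    push_cast
    rfl
  have body : ∀ t < q + 1, ∀ s', J t s' ∧ s' 10 0 = t → Ends
      (.seq (mapLoop 9 13 (.op .mul (.const (E * dout : ℕ)) (reg 8)) (yatesExpr E din dout K src))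
        (.seq (mapLoop 9 src (.op .mul (.const (E * dout : ℕ)) (reg 8)) (.read 13 (reg 9)))
          (.assign 8 (.const 0) (.op .mul (.op .div (reg 8) (.const din)) (.const dout))))) s'
      ((w₂ + w₃ + w₄) * ((Λ + 1) * (β + 1) ^ 2))
      (fun s'' => BitsLE β s'' ∧ s'' 10 0 = t ∧
        (J (t + 1) (s''.store 10 0 (t + 1)) ∧ (s''.store 10 0 (t + 1)) 10 0 = (t + 1 : ℕ))) := by
    rintro t ht s' ⟨⟨b1, b2, b3, b4, b5⟩, hcnt⟩
    have htq : t ≤ q := Nat.lt_succ_iff.1 ht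
    have b5 := b5 htq
    set m : ℕ := dout ^ t * din ^ (q - t) with hm
    have hlenm : E * (dout * m) = E * (dout ^ (t + 1) * din ^ (q - t)) := by rw [hm]; ring
    have hinm : E * (din * m) = E * (dout ^ t * din ^ (q + 1 - t)) := by
      rw [hm, show q + 1 - t = q - t + 1 by omega, pow_succ]; ring
    have hL : E * (dout * m) ≤ Λ := hlenm ▸ hΛ t htq
    have hLβ := bitLength_natCast_mono hL hΛβ
    have hv : ∀ i < E * (dout * m), |yatesIter E din dout K q X (t + 1) i| ≤
        2 ^ (c * (t + 1) + l) := by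
      intro i hi
      have := abs_yatesStep_le (X := yatesIter E din dout K q X t) (M := 2 ^ (c * t + l)) hc
        (fun j hj => by rw [← b4 j (hinm ▸ hj)]; exact b3 _) (by positivity) hi
      rw [← pow_add] at this
      rw [yatesIter]
      refine this.trans_eq ?_
      congr 1
      ring
    have hβt : ((2 : ℤ)) ^ (c * (t + 1) + l) < 2 ^ β := by
      refine pow_lt_pow_right₀ (by norm_num) (lt_of_le_of_lt ?_ hβ)
      gcongr
    have hvβ : ∀ i < E * (dout * m), bitLength (yatesIter E din dout K q X (t + 1) i) ≤ β :=
      fun i hi => bitLength_le_iff.2 ((hv i hi).trans_lt hβt)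
    have hlen' : ∀ s₁ : RamState, s₁ 8 = s' 8 →
        (RamExpr.op .mul (.const (E * dout : ℕ)) (reg 8)).eval s₁ = (E * (dout * m) : ℕ) := by
      intro s₁ h
      simp only [RamExpr.eval, RamOp.eval, reg_eval, h, b5]
      push_cast
      ring
    have step1 := h₂ s' β (E * (dout * m)) (yatesIter E din dout K q X (t + 1)) b1
      (fun s₁ h => hlen' s₁ (h 8 (by norm_num) (by norm_num)))
      (fun i hi s₁ h h9' => by
        rw [yatesExpr_eval K h9' (by rw [h 8 (by norm_num) (by norm_num), b5]) hi, yatesIter]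
        refine Finset.sum_congr rfl fun x hx => ?_
        simp only [h src h9 h13]
        rw [b4]
        rw [← hinm]
        have hm0 : 0 < m := Nat.pos_of_ne_zero fun h => by simp [h] at hi
        have h3 : i / E % m + 1 ≤ m := Nat.mod_lt _ hm0
        have h2 := Finset.mem_range.1 hx
        calc x + E * din * (i / E % m) < E * din * (i / E % m + 1) := by rw [Nat.mul_succ]; omega
          _ ≤ E * din * m := Nat.mul_le_mul_left _ h3
          _ = _ := mul_assoc _ _ _) hvβ hLβ
    have := step1.seq fun s₁ ⟨d1, d2, d3, _⟩ =>
      (h₃ s₁ β (E * (dout * m)) (yatesIter E din dout K q X (t + 1)) d1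
        (fun s₂ h => hlen' s₂ (by rw [h 8 (by norm_num) h8.symm, d2 8 (by norm_num) (by norm_num)]))
        (fun i hi s₂ h h9' => by
          simp only [RamExpr.eval, reg_eval, h9', h 13 (by norm_num) h13.symm, d3 i hi]) hvβ hLβ).seq
      fun s₂ ⟨f1, f2, f3, f4⟩ => by
        have g8 : s₂ 8 0 = m := by
          rw [f2 8 (by norm_num) h8.symm, d2 8 (by norm_num) (by norm_num), b5]
        have heval : (RamExpr.op .mul (.op .div (reg 8) (.const din)) (.const dout)).eval s₂ =
            (m / din * dout : ℕ) := by
          simp only [RamExpr.eval, RamOp.eval, reg_eval, g8]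
          push_cast
          rfl
        refine h₄ s₂ β (fun s'' => BitsLE β s'' ∧ s'' 10 0 = t ∧
          (J (t + 1) (s''.store 10 0 (t + 1)) ∧ (s''.store 10 0 (t + 1)) 10 0 = (t + 1 : ℕ))) f1 ?_
        rw [heval]
        have hb : bitLength (m / din * dout : ℕ) ≤ β := by
          refine bitLength_natCast_mono ?_ hLβ
          calc m / din * dout ≤ m * dout := Nat.mul_le_mul_right _ (Nat.div_le_self _ _)
            _ = dout * m := mul_comm _ _
            _ ≤ _ := Nat.le_mul_of_pos_left _ hE
        have g1 := f1.store 8 0 hb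
        refine ⟨g1, ?_, hJ _ _ _ ?_ ⟨g1, ?_, ?_, ?_, ?_⟩, ?_⟩
        · rw [RamExpr.eval, RamState.store_of_ne _ (by norm_num), f2 10 (by norm_num) h10.symm,
            d2 10 (by norm_num) (by norm_num), hcnt]
        · exact_mod_cast bitLength_natCast_mono (show t + 1 ≤ q + 1 by omega) hqβ
        · intro a a8 a9 a10 a13 as
          rw [RamExpr.eval, RamState.store_of_ne _ a8, f2 a a9 as, d2 a a9 a13, b2 a a8 a9 a10 a13 as]
        · intro i
          rw [RamExpr.eval, RamState.store_of_ne _ h8]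
          -- Cells outside the range just written keep their content and hence the weaker bound of
          -- the previous step.
          by_cases hi : ∃ k < E * (dout * m), i = (k : ℕ)
          · obtain ⟨k, hk, rfl⟩ := hi
            rw [f3 k hk]
            exact hv k hk
          · push Not at hi
            rw [f4 i hi, d2 src h9 h13]
            refine (b3 i).trans (pow_le_pow_right₀ (by norm_num) ?_)
            gcongr
            omega
        · intro i hi
          rw [RamExpr.eval, RamState.store_of_ne _ h8, f3]
          rw [hlenm]
          rwa [Nat.add_sub_add_right] at hi
        · intro ht1
          rw [RamExpr.eval, RamState.store_self, hm, show q - t = q - (t + 1) + 1 by omega, pow_succ,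
            ← mul_assoc, Nat.mul_div_cancel _ hdin]
          push_cast
          ring
        · rw [RamState.store_self]
          push_cast
          rfl
    refine this.mono ?_ fun _ h => h
    have h6 : E * (dout * m) + 1 ≤ Λ + 1 := by omega
    calc _ ≤ w₂ * ((Λ + 1) * (β + 1) ^ 2) + (w₃ * ((Λ + 1) * (β + 1) ^ 2) +
          w₄ * ((Λ + 1) * (β + 1) ^ 2)) := by
          gcongr
          exact Nat.le_mul_of_pos_left _ (Nat.succ_pos _)
      _ = _ := by ring
  have := start.seq fun s₁ ⟨d1, d2, d3⟩ =>
    h₅ s₁ β (q + 1) ((w₂ + w₃ + w₄) * ((Λ + 1) * (β + 1) ^ 2))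
      (fun t s' => J t s' ∧ s' 10 0 = t) d1
      ⟨hJ 0 s₁ 0 (by simp [bitLength]) ⟨d1, fun a a8 a9 _ _ _ => d2 a a9 a8, fun i => by
          rw [d2 src h9 h8]; simpa using hl i, fun i _ => by rw [d2 src h9 h8]; rfl,
          fun _ => by rw [d3]; simp⟩,
        by simp [RamState.store_self]⟩
      (fun t _ s' hs' => ⟨hs'.1.1, hs'.2, hlen s' (hs'.1.2.1 4 (by norm_num) (by norm_num)
        (by norm_num) (by norm_num) h4.symm)⟩) body
  refine this.mono ?_ fun s' hs' => ?_
  · have e1 : (q + 1) * (β + 1) ^ 2 ≤ (q + 2) * ((Λ + 1) * (β + 1) ^ 2) := by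
      gcongr
      · omega
      · exact Nat.le_mul_of_pos_left _ (Nat.succ_pos _)
    have e2 : (q + 1) * ((w₂ + w₃ + w₄) * ((Λ + 1) * (β + 1) ^ 2)) ≤
        (w₂ + w₃ + w₄) * ((q + 2) * ((Λ + 1) * (β + 1) ^ 2)) := by
      calc _ = (w₂ + w₃ + w₄) * ((q + 1) * ((Λ + 1) * (β + 1) ^ 2)) := by ring
        _ ≤ _ := by gcongr; omega
    have e3 : (q + 1 + 1) * (w₅ * (β + 1) ^ 2) ≤ w₅ * ((q + 2) * ((Λ + 1) * (β + 1) ^ 2)) := by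
      calc _ = w₅ * ((q + 2) * (β + 1) ^ 2) := by ring
        _ ≤ _ := by gcongr; exact Nat.le_mul_of_pos_left _ (Nat.succ_pos _)
    have e4 := Nat.mul_le_mul_left w₁ e1
    calc _ ≤ _ := Nat.add_le_add e4 (Nat.add_le_add e2 e3)
      _ = _ := by ring
  · obtain ⟨⟨b1, b2, b3, b4, -⟩, -⟩ := hs'
    exact ⟨b1, b2, b3, fun i hi => b4 i (by simpa using hi)⟩

/-! ### The program for the join convolution -/

/-- Available for all large `c`, so that a single constant serves all three transforms. -/
theorem exists_abs_row_sum_le (E din dout : ℕ) (K : ℕ → ℕ → ℕ → ℤ) :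
    ∃ c₀ : ℕ, ∀ c, c₀ ≤ c → ∀ e < E, ∀ ρ < dout, ∑ x ∈ range (E * din), |K e ρ x| ≤ 2 ^ c := by
  refine ⟨∑ e ∈ range E, ∑ ρ ∈ range dout, ∑ x ∈ range (E * din), (K e ρ x).natAbs,
    fun c hc e he ρ hρ => ?_⟩
  have h1 : ∑ x ∈ range (E * din), (K e ρ x).natAbs ≤ c := by
    refine le_trans ?_ hc
    refine le_trans ?_ (Finset.single_le_sum (f := fun e => ∑ ρ ∈ range dout,
      ∑ x ∈ range (E * din), (K e ρ x).natAbs) (fun _ _ => Nat.zero_le _) (Finset.mem_range.2 he))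
    exact Finset.single_le_sum (f := fun ρ => ∑ x ∈ range (E * din), (K e ρ x).natAbs)
      (fun _ _ => Nat.zero_le _) (Finset.mem_range.2 hρ)
  have h2 : ∑ x ∈ range (E * din), |K e ρ x| =
      ((∑ x ∈ range (E * din), (K e ρ x).natAbs : ℕ) : ℤ) := by
    push_cast
    rfl
  rw [h2]
  exact_mod_cast h1.trans Nat.lt_two_pow_self.le

namespace BlockDecomposition

variable {s R D : ℕ} (B : BlockDecomposition s R D)

def blockCount : RamExpr := .op .add (reg 4) (.const 1)

/-- Array `12` holds the first factor with its bond, array `2` the second factor, transformed in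
place, and array `14` the pointwise products. Cell `7` holds powers giving array lengths, and cell
`5` the denominator to be removed at the end. -/
def program : RamProgram :=
  .seq (.assign 4 (.const 0) (divExpr (reg 0) (.const s)))
  (.seq (powLoop 10 7 blockCount (6 ^ s))
  (.seq (mapLoop 9 12 (.op .mul (.const 4) (reg 7)) (.op .mul
    (.read 1 (divExpr (reg 9) (.const (4 : ℕ)))) (indicatorExpr 0 (modExpr (reg 9) (.const (4 : ℕ))))))
  (.seq (yatesProgram 4 (6 ^ s) R B.KU 12)
  (.seq (yatesProgram 1 (6 ^ s) R B.KV 2)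
  (.seq (powLoop 10 7 blockCount R)
  (.seq (mapLoop 9 14 (reg 7) (.op .mul
    (sumExpr (fun e => .read 12 (.op .add (.const e) (.op .mul (.const 4) (reg 9)))) 4)
    (.read 2 (reg 9))))
  (.seq (yatesProgram 1 R (6 ^ s) B.KW 14)
  (.seq (powLoop 10 7 blockCount (6 ^ s))
  (.seq (powLoop 10 5 blockCount D)
  (mapLoop 9 3 (reg 7) (.op .div (.read 14 (reg 9)) (reg 5))))))))))))

theorem ends_program (hD : 0 < D) (hR : 6 ^ s ≤ R) : ∃ w c : ℕ,
    ∀ (st : RamState) (n L q : ℕ), st 0 0 = n → (∀ i, st 12 i = 0) → (∀ i, st 14 i = 0) →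
      BitsLE (n + L) st → q = n / s →
      Ends B.program st (w * ((q + 2) * ((4 * R ^ (q + 1) + 1) *
        (3 * (c * (q + 1)) + 2 * (n + L) + 3 + 1) ^ 2))) fun s' =>
        ∀ k < (6 ^ s) ^ (q + 1), s' 3 (k : ℕ) =
          ∑ i ∈ range ((6 ^ s) ^ (q + 1)), ∑ j ∈ range ((6 ^ s) ^ (q + 1)),
            st 1 (i : ℕ) * st 2 (j : ℕ) * wordTensor (s * (q + 1)) i j k := by
  have hd : 0 < 6 ^ s := by positivity
  have hR0 : 0 < R := hd.trans_le hR
  obtain ⟨cU, hcU⟩ := exists_abs_row_sum_le 4 (6 ^ s) R B.KU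
  obtain ⟨cV, hcV⟩ := exists_abs_row_sum_le 1 (6 ^ s) R B.KV
  obtain ⟨cW, hcW⟩ := exists_abs_row_sum_le 1 R (6 ^ s) B.KW
  -- Including `R` and `D` makes the powers of `R`, of `D` and of `6 ^ s ≤ R` fit into `c * (q + 1)`
  -- bits.
  obtain ⟨c, hc⟩ : ∃ c, c = cU + cV + cW + R + D := ⟨_, rfl⟩
  obtain ⟨w₁, h₁⟩ := ends_assign 4 (.const 0) (divExpr (reg 0) (.const s))
  obtain ⟨w₂, h₂⟩ := ends_powLoop (cnt := 10) (dst := 7) (by norm_num) blockCount (6 ^ s)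
  obtain ⟨w₃, h₃⟩ := ends_mapLoop (cnt := 9) (dst := 12) (by norm_num)
    (.op .mul (.const 4) (reg 7)) (.op .mul
    (.read 1 (divExpr (reg 9) (.const (4 : ℕ)))) (indicatorExpr 0 (modExpr (reg 9) (.const (4 : ℕ)))))
  obtain ⟨w₄, h₄⟩ := ends_yatesProgram (E := 4) (src := 12) (K := B.KU) (by norm_num) hd hR0
    (by norm_num) (by norm_num) (by norm_num) (by norm_num) (by norm_num) (hcU c (by omega))
  obtain ⟨w₅, h₅⟩ := ends_yatesProgram (E := 1) (src := 2) (K := B.KV) (by norm_num) hd hR0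
    (by norm_num) (by norm_num) (by norm_num) (by norm_num) (by norm_num) (hcV c (by omega))
  obtain ⟨w₆, h₆⟩ := ends_powLoop (cnt := 10) (dst := 7) (by norm_num) blockCount R
  obtain ⟨w₇, h₇⟩ := ends_mapLoop (cnt := 9) (dst := 14) (by norm_num) (reg 7) (.op .mul
    (sumExpr (fun e => .read 12 (.op .add (.const e) (.op .mul (.const 4) (reg 9)))) 4)
    (.read 2 (reg 9)))
  obtain ⟨w₈, h₈⟩ := ends_yatesProgram (E := 1) (src := 14) (K := B.KW) (by norm_num) hR0 hd
    (by norm_num) (by norm_num) (by norm_num) (by norm_num) (by norm_num) (hcW c (by omega))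
  obtain ⟨w₉, h₉⟩ := ends_powLoop (cnt := 10) (dst := 5) (by norm_num) blockCount D
  obtain ⟨w₁₀, h₁₀⟩ := ends_mapLoop (cnt := 9) (dst := 3) (by norm_num) (reg 7)
    (.op .div (.read 14 (reg 9)) (reg 5))
  refine ⟨w₁ + (w₂ + (w₃ + (w₄ + (w₅ + (w₆ + (w₇ + (w₈ + (w₂ + (w₉ + w₁₀))))))))), c,
    fun st n L q h0 h12 h14 hst hq => ?_⟩
  have hqn : q ≤ n := hq ▸ Nat.div_le_self _ _
  obtain ⟨Λ, hΛ⟩ : ∃ Λ, Λ = 4 * R ^ (q + 1) := ⟨_, rfl⟩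
  -- A transformed factor has magnitude at most `2 ^ (c * (q + 1) + n + L)`. The product of the two,
  -- with the sum over four bonds, doubles this exponent and adds two; the last transform adds `c *
  -- (q + 1)`, and one more bit makes the inequality strict.
  obtain ⟨β, hβ⟩ : ∃ β, β = 3 * (c * (q + 1)) + 2 * (n + L) + 3 := ⟨_, rfl⟩
  rw [← hΛ, ← hβ]
  obtain ⟨Θ, hΘ⟩ : ∃ Θ, Θ = (q + 2) * ((Λ + 1) * (β + 1) ^ 2) := ⟨_, rfl⟩
  rw [← hΘ]
  -- bounds
  have hst' : ∀ a i, |st a i| ≤ 2 ^ (n + L) := fun a i => (bitLength_le_iff.1 (hst a i)).le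
  have hstβ : BitsLE β st := fun a i => (hst a i).trans (by omega)
  have hpow2 : ∀ {x : ℤ} {e : ℕ}, |x| ≤ 2 ^ e → e < β → bitLength x ≤ β := fun hx he =>
    bitLength_le_iff.2 (hx.trans_lt (pow_lt_pow_right₀ (by norm_num) he))
  have hpowc : ∀ {b i : ℕ}, b ≤ c → i ≤ q + 1 → b ^ i ≤ 2 ^ (c * (q + 1)) := by
    intro b i hb hi
    calc b ^ i ≤ (2 ^ c) ^ i := Nat.pow_le_pow_left (hb.trans Nat.lt_two_pow_self.le) i
      _ ≤ (2 ^ c) ^ (q + 1) := Nat.pow_le_pow_right (by positivity) hi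
      _ = _ := (pow_mul _ _ _).symm
  have hpowb : ∀ {b : ℕ}, b ≤ c → ∀ i ≤ q + 1, bitLength ((b : ℤ) ^ i) ≤ β := by
    intro b hb i hi
    refine hpow2 (e := c * (q + 1)) ?_ (by omega)
    rw [abs_of_nonneg (by positivity)]
    exact_mod_cast hpowc hb hi
  have hΛβ : bitLength Λ ≤ β := by
    refine hpow2 (e := c * (q + 1) + 2) ?_ (by omega)
    rw [Nat.abs_cast, hΛ, pow_add (2 : ℤ)]
    have := hpowc (show R ≤ c by omega) (le_refl (q + 1))
    have : (R : ℤ) ^ (q + 1) ≤ 2 ^ (c * (q + 1)) := by exact_mod_cast this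
    push_cast
    linarith
  have hΛ0 : ∀ {x}, x ≤ 4 * R ^ (q + 1) → bitLength (x : ℕ) ≤ β := fun hx =>
    bitLength_natCast_mono (hΛ ▸ hx) hΛβ
  have hqβ : bitLength (q + 1 : ℕ) ≤ β := by
    refine hpow2 (e := n + 1) ?_ (by omega)
    rw [Nat.abs_cast]
    exact_mod_cast (Nat.succ_le_succ hqn).trans Nat.lt_two_pow_self.le
  have hdR : (6 ^ s) ^ (q + 1) ≤ R ^ (q + 1) := Nat.pow_le_pow_left hR _
  have hmix : ∀ t ≤ q, R ^ (t + 1) * (6 ^ s) ^ (q - t) ≤ R ^ (q + 1) := by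
    intro t ht
    calc R ^ (t + 1) * (6 ^ s) ^ (q - t) ≤ R ^ (t + 1) * R ^ (q - t) := by gcongr
      _ = _ := by rw [← pow_add]; congr 1; omega
  have hmix' : ∀ t ≤ q, (6 ^ s) ^ (t + 1) * R ^ (q - t) ≤ R ^ (q + 1) := by
    intro t ht
    calc (6 ^ s) ^ (t + 1) * R ^ (q - t) ≤ R ^ (t + 1) * R ^ (q - t) := by gcongr
      _ = _ := by rw [← pow_add]; congr 1; omega
  -- times
  have t1 : (β + 1) ^ 2 ≤ Θ := by
    rw [hΘ, ← mul_assoc]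
    exact Nat.le_mul_of_pos_left _ (by positivity)
  have t2 : (q + 1 + 1) * (β + 1) ^ 2 ≤ Θ := by
    rw [hΘ]
    exact Nat.mul_le_mul_left _ (Nat.le_mul_of_pos_left _ (by positivity))
  have t3 : ∀ {x}, x ≤ 4 * R ^ (q + 1) → (x + 1) * (β + 1) ^ 2 ≤ Θ := by
    intro x hx
    rw [hΘ]
    refine le_trans ?_ (Nat.le_mul_of_pos_left _ (by positivity))
    rw [hΛ]
    gcongr
  have hcount : ∀ s' : RamState, s' 4 0 = q → blockCount.eval s' = (q + 1 : ℕ) := by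
    intro s' h
    simp only [blockCount, RamExpr.eval, RamOp.eval, reg_eval, h]
    push_cast
    rfl
  simp only [add_mul]
  -- the number of blocks
  refine ((h₁ st β (fun s₁ => BitsLE β s₁ ∧ (∀ a, a ≠ 4 → s₁ a = st a) ∧ s₁ 4 0 = q) hstβ
    ?_).mono (Nat.mul_le_mul_left _ t1) fun _ h => h).seq fun s₁ ⟨b1, f1, r1⟩ => ?_
  · have : (divExpr (reg 0) (.const s)).eval st = q := by
      rw [hq]
      exact divExpr_eval h0 rfl
    rw [this]
    refine ⟨hstβ.store _ _ (bitLength_natCast_mono (Nat.le_succ q) hqβ),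
      fun a ha => RamState.store_of_ne _ ha _ _, RamState.store_self _ _ _ _⟩
  -- the table of the first factor, with bonds
  refine ((h₂ s₁ β (q + 1) b1 (fun s' h => hcount s' (by
    rw [h 4 (by norm_num) (by norm_num), r1])) (hpowb (by omega)) hqβ).mono
    (Nat.mul_le_mul_left _ t2) fun _ h => h).seq fun s₂ ⟨b2, f2, r2⟩ => ?_
  set A : ℕ → ℤ := fun i => if i % 4 = 0 then st 1 (i / 4 : ℕ) else 0 with hA
  have hAle : ∀ i, |A i| ≤ 2 ^ (n + L) := by
    intro i
    simp only [hA]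
    split_ifs
    · exact hst' _ _
    · simp
  have hd4 : 4 * (6 ^ s) ^ (q + 1) ≤ 4 * R ^ (q + 1) := Nat.mul_le_mul_left _ hdR
  refine ((h₃ s₂ β (4 * (6 ^ s) ^ (q + 1)) A b2 (fun s' h => by
    simp only [RamExpr.eval, RamOp.eval, reg_eval, h 7 (by norm_num) (by norm_num), r2]
    push_cast
    rfl) (fun i hi s' h h9 => by
      have e1 : (divExpr (reg 9) (.const (4 : ℕ))).eval s' = ((i / 4 : ℕ) : ℤ) := divExpr_eval h9 rfl
      have e2 : (modExpr (reg 9) (.const (4 : ℕ))).eval s' = ((i % 4 : ℕ) : ℤ) := modExpr_eval h9 rfl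
      rw [RamExpr.eval, indicatorExpr_eval e2, RamExpr.eval, e1, h 1 (by norm_num) (by norm_num),
        f2 1 (by norm_num) (by norm_num), f1 1 (by norm_num)]
      simp only [RamOp.eval, hA, mul_ite, mul_one, mul_zero, eq_comm])
    (fun i _ => hpow2 (hAle i) (by omega)) (hΛ0 hd4)).mono
    (Nat.mul_le_mul_left _ (t3 hd4)) fun _ h => h).seq fun s₃ ⟨b3, f3, v3, o3⟩ => ?_
  have A3 : ∀ i, |s₃ 12 i| ≤ 2 ^ (n + L) := by
    intro i
    by_cases hi : ∃ k < 4 * (6 ^ s) ^ (q + 1), i = (k : ℕ)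
    · obtain ⟨k, hk, rfl⟩ := hi
      rw [v3 k hk]
      exact hAle k
    · push Not at hi
      rw [o3 i hi, f2 12 (by norm_num) (by norm_num), f1 12 (by norm_num)]
      exact hst' _ _
  have q3 : s₃ 4 0 = q := by
    rw [f3 4 (by norm_num) (by norm_num), f2 4 (by norm_num) (by norm_num), r1]
  -- the transforms of the two factors
  refine ((h₄ s₃ β q (n + L) Λ b3 q3 (fun t ht => hΛ ▸ Nat.mul_le_mul_left _ (hmix t ht)) hΛβ hqβ
    A3 (by omega)).mono (Nat.mul_le_mul_left _ hΘ.ge) fun _ h => h).seq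
    fun s₄ ⟨b4, f4, A4, v4⟩ => ?_
  have g4 : s₄ 2 = st 2 := by
    rw [f4 2 (by norm_num) (by norm_num) (by norm_num) (by norm_num) (by norm_num),
      f3 2 (by norm_num) (by norm_num), f2 2 (by norm_num) (by norm_num), f1 2 (by norm_num)]
  have q4 : s₄ 4 0 = q := by
    rw [f4 4 (by norm_num) (by norm_num) (by norm_num) (by norm_num) (by norm_num), q3]
  refine ((h₅ s₄ β q (n + L) Λ b4 q4 (fun t ht => by
    rw [hΛ, one_mul]; exact (hmix t ht).trans (Nat.le_mul_of_pos_left _ (by norm_num))) hΛβ hqβ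
    (fun i => by rw [g4]; exact hst' _ _) (by omega)).mono (Nat.mul_le_mul_left _ hΘ.ge)
    fun _ h => h).seq fun s₅ ⟨b5, f5, A5, v5⟩ => ?_
  have q5 : s₅ 4 0 = q := by
    rw [f5 4 (by norm_num) (by norm_num) (by norm_num) (by norm_num) (by norm_num), q4]
  -- the products
  refine ((h₆ s₅ β (q + 1) b5 (fun s' h => hcount s' (by
    rw [h 4 (by norm_num) (by norm_num), q5])) (hpowb (by omega)) hqβ).mono
    (Nat.mul_le_mul_left _ t2) fun _ h => h).seq fun s₆ ⟨b6, f6, r6⟩ => ?_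
  have g12 : s₆ 12 = s₄ 12 := by
    rw [f6 12 (by norm_num) (by norm_num),
      f5 12 (by norm_num) (by norm_num) (by norm_num) (by norm_num) (by norm_num)]
  have g2 : s₆ 2 = s₅ 2 := f6 2 (by norm_num) (by norm_num)
  set P : ℕ → ℤ := fun i => (∑ e ∈ range 4, s₄ 12 ((e + 4 * i : ℕ) : ℤ)) * s₅ 2 (i : ℕ) with hP
  have hPle : ∀ i, |P i| ≤ 2 ^ (2 * (c * (q + 1) + (n + L)) + 2) := by
    intro i
    simp only [hP]
    rw [abs_mul]
    have e1 : |∑ e ∈ range 4, s₄ 12 ((e + 4 * i : ℕ) : ℤ)| ≤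
        4 * 2 ^ (c * (q + 1) + (n + L)) := by
      refine (Finset.abs_sum_le_sum_abs _ _).trans ?_
      refine (Finset.sum_le_card_nsmul _ _ _ fun e _ => A4 _).trans_eq ?_
      simp
    calc _ ≤ 4 * 2 ^ (c * (q + 1) + (n + L)) * 2 ^ (c * (q + 1) + (n + L)) :=
          mul_le_mul e1 (A5 _) (abs_nonneg _) (by positivity)
      _ = _ := by ring
  have hR4 : R ^ (q + 1) ≤ 4 * R ^ (q + 1) := Nat.le_mul_of_pos_left _ (by norm_num)
  refine ((h₇ s₆ β (R ^ (q + 1)) P b6 (fun s' h => by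
    rw [reg_eval, h 7 (by norm_num) (by norm_num), r6]
    push_cast
    rfl) (fun i hi s' h h9 => by
      simp only [RamExpr.eval, RamOp.eval, sumExpr_eval, reg_eval, h9,
        h 12 (by norm_num) (by norm_num), h 2 (by norm_num) (by norm_num), g12, g2, hP]
      push_cast
      rfl) (fun i _ => hpow2 (hPle i) (by omega)) (hΛ0 hR4)).mono
    (Nat.mul_le_mul_left _ (t3 hR4)) fun _ h => h).seq fun s₇ ⟨b7, f7, v7, o7⟩ => ?_
  have g14 : s₆ 14 = st 14 := by
    rw [f6 14 (by norm_num) (by norm_num),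
      f5 14 (by norm_num) (by norm_num) (by norm_num) (by norm_num) (by norm_num),
      f4 14 (by norm_num) (by norm_num) (by norm_num) (by norm_num) (by norm_num),
      f3 14 (by norm_num) (by norm_num), f2 14 (by norm_num) (by norm_num), f1 14 (by norm_num)]
  have A7 : ∀ i, |s₇ 14 i| ≤ 2 ^ (2 * (c * (q + 1) + (n + L)) + 2) := by
    intro i
    by_cases hi : ∃ k < R ^ (q + 1), i = (k : ℕ)
    · obtain ⟨k, hk, rfl⟩ := hi
      rw [v7 k hk]
      exact hPle k
    · push Not at hi
      -- Array `14` is untouched so far, so its cells beyond the products are still zero.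
      rw [o7 i hi, g14, h14]
      simp
  have q7 : s₇ 4 0 = q := by
    rw [f7 4 (by norm_num) (by norm_num), f6 4 (by norm_num) (by norm_num), q5]
  -- the transform of the products
  refine ((h₈ s₇ β q _ Λ b7 q7 (fun t ht => by
    rw [hΛ, one_mul]; exact (hmix' t ht).trans hR4) hΛβ hqβ A7 (by omega)).mono
    (Nat.mul_le_mul_left _ hΘ.ge) fun _ h => h).seq fun s₈ ⟨b8, f8, A8, v8⟩ => ?_
  have q8 : s₈ 4 0 = q := by
    rw [f8 4 (by norm_num) (by norm_num) (by norm_num) (by norm_num) (by norm_num), q7]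
  refine ((h₂ s₈ β (q + 1) b8 (fun s' h => hcount s' (by
    rw [h 4 (by norm_num) (by norm_num), q8])) (hpowb (by omega)) hqβ).mono
    (Nat.mul_le_mul_left _ t2) fun _ h => h).seq fun s₉ ⟨b9, f9, r9⟩ => ?_
  refine ((h₉ s₉ β (q + 1) b9 (fun s' h => hcount s' (by
    rw [h 4 (by norm_num) (by norm_num), f9 4 (by norm_num) (by norm_num), q8]))
    (hpowb (by omega)) hqβ).mono
    (Nat.mul_le_mul_left _ t2) fun _ h => h).seq fun s' ⟨b', f', r'⟩ => ?_
  -- the output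
  have g14' : s' 14 = s₈ 14 := by
    rw [f' 14 (by norm_num) (by norm_num), f9 14 (by norm_num) (by norm_num)]
  have r7' : s' 7 0 = ((6 ^ s : ℕ) : ℤ) ^ (q + 1) := by
    rw [f' 7 (by norm_num) (by norm_num), r9]
  have hdle : (6 ^ s) ^ (q + 1) ≤ 4 * R ^ (q + 1) := hdR.trans hR4
  refine (h₁₀ s' β ((6 ^ s) ^ (q + 1)) (fun i => s₈ 14 (i : ℕ) / (D : ℤ) ^ (q + 1)) b'
    (fun s'' h => by
      rw [reg_eval, h 7 (by norm_num) (by norm_num), r7']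
      push_cast
      rfl)
    (fun i hi s'' h h9 => by
      simp only [RamExpr.eval, RamOp.eval, reg_eval, h9,
        h 14 (by norm_num) (by norm_num), h 5 (by norm_num) (by norm_num), g14', r'])
    (fun i _ => by
      refine (?_ : _ ≤ bitLength (s₈ 14 (i : ℕ))).trans (b8 _ _)
      exact Nat.size_le_size (Int.natAbs_ediv_le_natAbs _ _)) (hΛ0 hdle)).mono
    (Nat.mul_le_mul_left _ (t3 hdle)) fun s'' ⟨_, _, v'', _⟩ k hk => ?_
  rw [v'' k hk, v8 k (by simpa using hk)]
  have key := B.transform_eq q (fun i => st 1 (i : ℕ)) (fun j => st 2 (j : ℕ))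
    (fun j => s₃ 12 (j : ℕ)) (fun j => s₇ 14 (j : ℕ)) ?_ ?_ k hk
  -- The transformed value is an integer multiple of `D ^ (q + 1)`, so the integer quotient is
  -- exact.
  · rw [key, Int.mul_ediv_cancel_left]
    positivity
  · intro i hi e he
    have : e + 4 * i < 4 * (6 ^ s) ^ (q + 1) := by omega
    rw [v3 _ this]
    simp only [hA, Nat.add_mul_mod_self_left, Nat.mod_eq_of_lt he]
    split_ifs with h
    · rw [h, zero_add, Nat.mul_div_cancel_left _ (by norm_num)]
    · rfl
  · intro ρ hρ
    simp only [v7 ρ hρ, hP]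
    rw [v5 ρ (by simpa using hρ), g4]
    congr 1
    refine Finset.sum_congr rfl fun e he => ?_
    have := Finset.mem_range.1 he
    rw [v4 _ (by omega)]

end BlockDecomposition

/-! ### Padding to whole blocks and the final bound -/

theorem joinConv_row_of_le {n N : ℕ} (hN : n ≤ N)
    {f g : Finset (Fin n) → Finset (Fin n) → Finset (Fin n) → ℤ}
    (hf : SupportedOnAllowed f) (hg : SupportedOnAllowed g) (k : ℕ) (hk : k < 6 ^ n) :
    joinConv f g (rowA n k) (rowB n k) (rowC n k) =
      ∑ i ∈ range (6 ^ N), ∑ j ∈ range (6 ^ N), tableOf n f (i : ℕ) * tableOf n g (j : ℕ) *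
        wordTensor N i j k := by
  obtain ⟨m, rfl⟩ := Nat.exists_eq_add_of_le hN
  have htab : ∀ (F : Finset (Fin n) → Finset (Fin n) → Finset (Fin n) → ℤ) (i : ℕ),
      tableOf n F (i : ℕ) = if i < 6 ^ n then F (rowA n i) (rowB n i) (rowC n i) else 0 := by
    intro F i
    have : (0 ≤ (i : ℤ) ∧ (i : ℤ) < 6 ^ n) ↔ i < 6 ^ n :=
      ⟨fun h => by exact_mod_cast h.2, fun h => ⟨by positivity, by exact_mod_cast h⟩⟩
    simp only [tableOf, this, Int.toNat_natCast]
  have hsub : range (6 ^ n) ⊆ range (6 ^ (n + m)) :=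
    Finset.range_subset_range.2 (Nat.pow_le_pow_right (by norm_num) hN)
  rw [joinConv_row hf hg, ← Finset.sum_subset hsub]
  · refine Finset.sum_congr rfl fun i hi => ?_
    rw [← Finset.sum_subset hsub]
    · refine Finset.sum_congr rfl fun j hj => ?_
      have hi := Finset.mem_range.1 hi
      have hj := Finset.mem_range.1 hj
      rw [htab, htab, if_pos hi, if_pos hj, wordTensor_add_zero hi hj hk]
    · intro j _ hj
      rw [htab g, if_neg (by simpa using hj), mul_zero, zero_mul]
  · intro i _ hi
    refine Finset.sum_eq_zero fun j _ => ?_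
    rw [htab f, if_neg (by simpa using hi), zero_mul, zero_mul]

theorem mainTheorem7 (ε : ℝ) (hε : 0 < ε) :
    ∃ (P : RamProgram) (K k : ℕ),
      ∀ (n L : ℕ) (f g : Finset (Fin n) → Finset (Fin n) → Finset (Fin n) → ℤ),
        SupportedOnAllowed f → SupportedOnAllowed g →
        (∀ A B C, bitLength (f A B C) ≤ L) → (∀ A B C, bitLength (g A B C) ≤ L) →
        ∃ (t : ℕ) (s : RamState),
          Runs P (inputState n f g) t s ∧
          IsOutput n (joinConv f g) s ∧
          (t : ℝ) ≤ K * ((n : ℝ) + L + 1) ^ k * ((2 : ℝ) ^ (matMulExponent + ε) + 2) ^ n := by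
  obtain ⟨s, R, D, hs, hD, h6, hR, ⟨B⟩⟩ := exists_blockDecomposition hε
  obtain ⟨w, c, hw⟩ := B.ends_program hD h6
  set X : ℝ := (2 : ℝ) ^ (matMulExponent + ε) + 2 with hX
  have hX1 : 1 ≤ X := by
    have : (0 : ℝ) < 2 ^ (matMulExponent + ε) := by positivity
    linarith
  -- The exponent `3` counts one factor for the number of blocks and two for the squared bit length;
  -- `10 = 2 * 5` comes from `e3` and `e4`, and `X ^ s` from the incomplete last block.
  refine ⟨B.program, ⌈10 * w * (3 * c + 4) ^ 2 * X ^ s⌉₊, 3, fun n L f g hf hg hfL hgL => ?_⟩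
  have hbits : BitsLE (n + L) (inputState n f g) := by
    have htab : ∀ (F : Finset (Fin n) → Finset (Fin n) → Finset (Fin n) → ℤ),
        (∀ A B C, bitLength (F A B C) ≤ L) → ∀ i, bitLength (tableOf n F i) ≤ n + L := by
      intro F hF i
      simp only [tableOf]
      split_ifs
      · exact (hF _ _ _).trans (Nat.le_add_left _ _)
      · simp [bitLength]
    intro a i
    simp only [inputState]
    split_ifs
    · refine (?_ : _ ≤ n).trans (Nat.le_add_right _ _)
      rw [bitLength_le_iff, Nat.abs_cast]
      exact_mod_cast Nat.lt_two_pow_self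
    · exact htab f hfL i
    · exact htab g hgL i
    · simp [bitLength]
  obtain ⟨t, s', hrun, ht, hout⟩ := hw (inputState n f g) n L (n / s) (by simp [inputState])
    (by simp [inputState]) (by simp [inputState]) hbits rfl
  -- With `n / s + 1` blocks every vertex is covered, also when `s` does not divide `n`.
  have hnN : n ≤ s * (n / s + 1) := by
    have := Nat.lt_mul_div_succ n hs
    omega
  refine ⟨t, s', hrun, fun i hi => ?_, ?_⟩
  · rw [joinConv_row_of_le hnN hf hg i hi, hout i (by
      rw [← pow_mul]
      exact hi.trans_le (Nat.pow_le_pow_right (by norm_num) hnN)), ← pow_mul]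
    rfl
  · set q := n / s with hq
    have hqn : q ≤ n := Nat.div_le_self _ _
    have hsq : s * q ≤ n := Nat.mul_div_le n s
    have e1 : ((R : ℝ)) ^ (q + 1) ≤ X ^ s * X ^ n := by
      calc (R : ℝ) ^ (q + 1) ≤ (X ^ s) ^ (q + 1) := by gcongr
        _ = X ^ s * X ^ (s * q) := by rw [← pow_mul, ← pow_add]; congr 1; ring
        _ ≤ X ^ s * X ^ n := by gcongr
    have hXsn : 1 ≤ X ^ s * X ^ n := one_le_mul_of_one_le_of_one_le (one_le_pow₀ hX1)
      (one_le_pow₀ hX1)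
    have hqn' : (q : ℝ) ≤ n := by exact_mod_cast hqn
    have hn0 : (0 : ℝ) ≤ n := by positivity
    have hL0 : (0 : ℝ) ≤ L := by positivity
    have hc0 : (0 : ℝ) ≤ c := by positivity
    have e2 : 3 * ((c : ℝ) * (q + 1)) + 2 * (n + L) + 3 + 1 ≤ (3 * c + 4) * (n + L + 1) := by
      nlinarith [mul_nonneg hc0 hL0, mul_le_mul_of_nonneg_left hqn' hc0]
    have e3 : (q : ℝ) + 2 ≤ 2 * (n + L + 1) := by linarith
    have e4 : 4 * (R : ℝ) ^ (q + 1) + 1 ≤ 5 * (X ^ s * X ^ n) := by linarith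
    calc (t : ℝ) ≤ w * ((q + 2) * ((4 * (R : ℝ) ^ (q + 1) + 1) *
          (3 * ((c : ℝ) * (q + 1)) + 2 * (n + L) + 3 + 1) ^ 2)) := by exact_mod_cast ht
      _ ≤ w * (2 * (n + L + 1) * (5 * (X ^ s * X ^ n) * ((3 * c + 4) * (n + L + 1)) ^ 2)) := by
          gcongr
      _ = 10 * w * (3 * c + 4) ^ 2 * X ^ s * (n + L + 1) ^ 3 * X ^ n := by ring
      _ ≤ _ := by
          gcongr
          exact Nat.le_ceil _
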